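/- Let $N\ge 1$, $p>1$ and $p_F:=1+2/N$. Write $x=(x',x_N)\in\mathbb R^{N-1}\times\mathbb R$, $\Omega:=\{x\in\mathbb R^N: x_N>0\}$, $\partial\Omega=\mathbb R^{N-1}\times\{0\}$ with surface measure $\sigma$ (for $N=1$, $\partial\Omega=\{0\}$ and $\sigma(\{0\})=1$), $\partial_\nu=-\partial_{x_N}$, $e_N=(0,\dots,0,1)$ and $y^*=(y',-y_N)$. Consider $$\partial_t u=\Delta u+u^p\ \text{ in }\Omega\times(0,\infty),\qquad \partial_t u+\partial_\nu u=0\ \text{ on }\partial\Omega\times(0,\infty),\qquad u(\cdot,0)=\phi^i\ \text{ in }\Omega,\quad u(\cdot,0)=\phi^b\ \text{ on }\partial\Omega, \tag{SH}$$ where $\phi=(\phi^i,\phi^b)$ and $\phi^i,\phi^b$ are nonnegative measurable functions on $\Omega$ and $\partial\Omega$. Let $\Gamma_N(x,t)=(4\pi t)^{-N/2}e^{-|x|^2/(4t)}$ and, for $x,y\in\overline\Omega$, $t>0$, $$G(x,y,t)=\Gamma_N(x-y,t)-\Gamma_N(x-y^*,t)-2\int_0^t(\partial_{x_N}\Gamma_N)(x-y^*+\tau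 e_N,t-\tau)\,d\tau ,$$ which is the (nonnegative) fundamental solution of the heat equation in $\Omega$ with the boundary condition $\partial_t u+\partial_\nu u=0$. Put $$[\mathsf G(t)\phi](x)=\int_\Omega G(x,y,t)\phi^i(y)\,dy+\int_{\partial\Omega}G(x,y,t)\phi^b(y)\,d\sigma(y).$$ A global-in-time positive (mild) solution of (SH) is a continuous function $u:\overline\Omega\times(0,\infty)\to(0,\infty)$ which is bounded on $\overline\Omega\times[a,b]$ for all $0<a<b<\infty$ and satisfies $$u(x,t)=[\mathsf G(t)\phi](x)+\int_0^t[\mathsf G(t-s)(u(s)^p,0)](x)\,ds,\qquad (x,t)\in\overline\Omega\times(0,\infty).$$ 1. If $1<p\le p_F$, then for no nonnegative measurable $\phi^i,\phi^b$ does (SH) possess a global-in-time positive solution. 2. If $p>p_F$, then there is $\delta>0$, depending only on $N$ and $p$, such that for all nonnegative measurable $\phi^i,\phi^b$ that are not both zero almost everywhere and satisfy $$\|\phi^i\|_{L^1(\Omega)}+\|\phi^b\|_{L^1(\partial\Omega)}+\|\phi^i\|_{L^\infty(\Omega)}+\|\phi^b\|_{L^\infty(\partial\Omega)}\le\delta,$$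 problem (SH) possesses a global-in-time positive solution. -/

import Mathlib

noncomputable section

open MeasureTheory Set
open scoped ENNReal

namespace DynHeat

/-- Points `x = (x', x_N)` of `ℝ^N = ℝ^(N-1) × ℝ`, for `N ≥ 1`. The Euclidean norm is always written
out as `|x|² = ‖x'‖² + x_N²`; the measure `volume` is Lebesgue measure and the topology is the usual
one. -/
abbrev Pt (N : ℕ) : Type := EuclideanSpace ℝ (Fin (N - 1)) × ℝ

/-- The boundary of the half-space, identified with `ℝ^(N-1)`. Its surface measure is `volume`; for
`N = 1` this is the unit mass at the single boundary point. -/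
abbrev Bd (N : ℕ) : Type := EuclideanSpace ℝ (Fin (N - 1))

/-- The open half-space `Ω = {x_N > 0}`. -/
def Omega (N : ℕ) : Set (Pt N) := {x | 0 < x.2}

/-- The closed half-space. -/
def OmegaBar (N : ℕ) : Set (Pt N) := {x | 0 ≤ x.2}

/-- The boundary point `(y', 0)`. -/
def bdPt {N : ℕ} (y : Bd N) : Pt N := (y, 0)

/-- The unit vector `e_N = (0, …, 0, 1)`. -/
def eN (N : ℕ) : Pt N := (0, 1)

/-- The reflection `y* = (y', -y_N)`. -/
def reflect {N : ℕ} (y : Pt N) : Pt N := (y.1, -y.2)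

/-- The Gauss kernel `Γ_N(x,t) = (4πt)^(-N/2) exp(-|x|²/(4t))`. -/
def gauss (N : ℕ) (x : Pt N) (t : ℝ) : ℝ :=
  (4 * Real.pi * t) ^ (-(N : ℝ) / 2) * Real.exp (-(‖x.1‖ ^ 2 + x.2 ^ 2) / (4 * t))

/-- The partial derivative `∂Γ_N/∂x_N`. -/
def gaussDN (N : ℕ) (x : Pt N) (t : ℝ) : ℝ :=
  deriv (fun z : ℝ => gauss N (x.1, z) t) x.2

/-- `H(x,y,t) = -2 ∫₀ᵗ (∂Γ_N/∂x_N)(x - y* + τ e_N, t - τ) dτ`. -/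
def kernelH (N : ℕ) (x y : Pt N) (t : ℝ) : ℝ :=
  -2 * ∫ τ in (0 : ℝ)..t, gaussDN N (x - reflect y + τ • eN N) (t - τ)

/-- The fundamental solution `G` of the heat equation in the half-space with the boundary condition
`∂_t u + ∂_ν u = 0`. -/
def kernelG (N : ℕ) (x y : Pt N) (t : ℝ) : ℝ :=
  gauss N (x - y) t - gauss N (x - reflect y) t + kernelH N x y t

theorem gauss_nonneg (N : ℕ) (x : Pt N) {t : ℝ} (ht : 0 ≤ t) : 0 ≤ gauss N x t := by
  unfold gauss; positivity

theorem gaussDN_eq (N : ℕ) (x : Pt N) (t : ℝ) :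
    gaussDN N x t = gauss N x t * (-(2 * x.2) / (4 * t)) := by
  have h : HasDerivAt (fun z : ℝ => gauss N (x.1, z) t)
      ((4 * Real.pi * t) ^ (-(N : ℝ) / 2) *
        (Real.exp (-(‖x.1‖ ^ 2 + x.2 ^ 2) / (4 * t)) * (-(2 * x.2) / (4 * t)))) x.2 := by
    have h1 : HasDerivAt (fun z : ℝ => -(‖x.1‖ ^ 2 + z ^ 2) / (4 * t))
        (-(2 * x.2) / (4 * t)) x.2 := by
      have h2 := (((hasDerivAt_pow 2 x.2).const_add (‖x.1‖ ^ 2)).neg).div_const (4 * t)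
      simpa using h2
    exact (h1.exp).const_mul _
  unfold gaussDN
  rw [h.deriv]
  unfold gauss
  ring

/-- `G ≥ 0` on the closed half-space: the integrals against `G` below may be taken in `[0,∞]`. -/
theorem kernelG_nonneg {N : ℕ} {x y : Pt N} (hx : x ∈ OmegaBar N) (hy : y ∈ OmegaBar N)
    {t : ℝ} (ht : 0 < t) : 0 ≤ kernelG N x y t := by
  have hx' : 0 ≤ x.2 := hx
  have hy' : 0 ≤ y.2 := hy
  have h1 : gauss N (x - reflect y) t ≤ gauss N (x - y) t := by
    unfold gauss
    refine mul_le_mul_of_nonneg_left ?_ (by positivity)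
    refine Real.exp_le_exp.2 ?_
    refine div_le_div_of_nonneg_right ?_ (by positivity)
    simp only [reflect, Prod.fst_sub, Prod.snd_sub]
    nlinarith [mul_nonneg hx' hy']
  have h2 : 0 ≤ kernelH N x y t := by
    have h3 : 0 ≤ ∫ τ in (0 : ℝ)..t, -gaussDN N (x - reflect y + τ • eN N) (t - τ) := by
      refine intervalIntegral.integral_nonneg ht.le fun τ hτ => ?_
      have h4 : 0 ≤ t - τ := by linarith [hτ.2]
      have h5 : (x - reflect y + τ • eN N).2 = x.2 + y.2 + τ := by
        simp [reflect, eN]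
      rw [gaussDN_eq, h5, neg_div, mul_neg, neg_neg]
      have h6 : 0 ≤ x.2 + y.2 + τ := by linarith [hτ.1]
      exact mul_nonneg (gauss_nonneg N _ h4) (by positivity)
    rw [intervalIntegral.integral_neg] at h3
    unfold kernelH
    linarith
  unfold kernelG
  linarith

/-- `[G(t)φ](x) = ∫_Ω G(x,y,t) φⁱ(y) dy + ∫_∂Ω G(x,y,t) φᵇ(y) dσ(y)` for nonnegative `φⁱ`, `φᵇ`, as an
element of `[0,∞]`. -/
def opG (N : ℕ) (t : ℝ) (φi : Pt N → ℝ) (φb : Bd N → ℝ) (x : Pt N) : ℝ≥0∞ :=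
  (∫⁻ y in Omega N, ENNReal.ofReal (kernelG N x y t * φi y)) +
    ∫⁻ y : Bd N, ENNReal.ofReal (kernelG N x (bdPt y) t * φb y)

/-- The times `0 < t < T`, where `T ∈ (0,∞]`. -/
def times (T : EReal) : Set ℝ := {t | 0 < t ∧ (t : EReal) < T}

/-- `u` is a solution, in `Ω × (0,T)` and with initial data `(φⁱ, φᵇ)`, of `∂_t u = Δu + u^p` in the
half-space with `∂_t u + ∂_ν u = 0` on its boundary: a nonnegative continuous function on
`closure Ω × (0,T)`, bounded in `x` locally uniformly in `t ∈ (0,T)`, that satisfies the integral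
equation `u(x,t) = [G(t)φ](x) + ∫₀ᵗ [G(t-s)(u(s)^p, 0)](x) ds`. Only the values of `u` on
`closure Ω × (0,T)` matter. As `u` is continuous there, its supremum is its essential supremum. -/
structure IsSolution (N : ℕ) (p : ℝ) (φi : Pt N → ℝ) (φb : Bd N → ℝ) (T : EReal)
    (u : Pt N → ℝ → ℝ) : Prop where
  nonneg : ∀ x ∈ OmegaBar N, ∀ t ∈ times T, 0 ≤ u x t
  continuousOn : ContinuousOn (fun z : Pt N × ℝ => u z.1 z.2) (OmegaBar N ×ˢ times T)
  locallyBounded : ∀ a ∈ times T, ∀ b ∈ times T,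
    ∃ M : ℝ, ∀ x ∈ OmegaBar N, ∀ t ∈ Icc a b, u x t ≤ M
  integral_eq : ∀ x ∈ OmegaBar N, ∀ t ∈ times T,
    ENNReal.ofReal (u x t) = opG N t φi φb x +
      ∫⁻ s in Ioo 0 t, opG N (t - s) (fun y => u y s ^ p) (fun _ => 0) x

/-- A global-in-time solution which is positive on all of `closure Ω × (0,∞)`. -/
def IsGlobalPositiveSolution (N : ℕ) (p : ℝ) (φi : Pt N → ℝ) (φb : Bd N → ℝ)
    (u : Pt N → ℝ → ℝ) : Prop :=
  IsSolution N p φi φb ⊤ u ∧ ∀ x ∈ OmegaBar N, ∀ t : ℝ, 0 < t → 0 < u x t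

/-- `φ = (φⁱ, φᵇ)` consists of nonnegative (Lebesgue) measurable functions on `Ω` and on `∂Ω`. -/
structure IsInitialData (N : ℕ) (φi : Pt N → ℝ) (φb : Bd N → ℝ) : Prop where
  measurable_interior : AEMeasurable φi (volume.restrict (Omega N))
  measurable_boundary : AEMeasurable φb volume
  nonneg_interior : ∀ y ∈ Omega N, 0 ≤ φi y
  nonneg_boundary : ∀ y, 0 ≤ φb y

/-- The norm `‖φ‖ = ‖φⁱ‖_{L^r(Ω)} + ‖φᵇ‖_{L^r(∂Ω)}`. -/
def pairNorm (N : ℕ) (r : ℝ≥0∞) (φi : Pt N → ℝ) (φb : Bd N → ℝ) : ℝ≥0∞ :=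
  eLpNorm φi r (volume.restrict (Omega N)) + eLpNorm φb r volume

/-- The exponent `p_F = 1 + 2/N`. -/
def pF (N : ℕ) : ℝ := 1 + 2 / (N : ℝ)

end DynHeat

end

/-!
The kernel `G` is the heat kernel of Brownian motion in the half-space that is sticky at the
boundary: `H(x, y, t)` is the time integral of the normal flux `(ρ / s) Γ_N((x' - y', ρ), s)` of the
Gauss kernel, at `ρ = x_N + y_N + τ`, `s = t - τ`. For large times it behaves like the Neumann heat
kernel, which is why the critical exponent is the one of the whole space. Only three facts about `G`
are needed, and the semigroup property is not among them:

* `G ≥ c t ^ (-N / 2)` in the parabolic region, up to the boundary (`exists_kernelG_lower`);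
* `G ≤ C (t ^ (-N / 2) + t ^ (-N))` (`kernelG_le`);
* the mass of `G` in the half-space and on its boundary is bounded uniformly in `x` and `t`
  (`lintegral_kernelG_le`), because the total flux is a complementary error function.

*Nonexistence for `p ≤ p_F`.* A positive solution is at least `A t ^ (-N / 2)` in the parabolic
region (`exists_parabolicLower`). Inserting this bound once into the Duhamel integral gains a factor
`∫ s ^ (-N (p - 1) / 2) ds ≥ ∫ ds / s`, hence `u ≥ L t ^ (-N / 2)` for every `L` and all large `t`
(`ParabolicLower.improve`). On a cylinder of size `√t` at distance `√t` from the boundary the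
Dirichlet heat kernel keeps a fixed fraction of the mass up to time `t`
(`exists_lintegral_core_lower`). So the infimum `m` of `u` over the cylinder satisfies
`m(t') ≥ c ∫ m ^ p ds` over `(t, t')`, which forces `m` to become infinite within time `t` if `L` is
large (`not_forall_core_lower`).

*Existence for `p > p_F`.* With values in `[0, ∞]` the Picard iteration from `0` is increasing and
its supremum solves the integral equation by monotone convergence. The bounds
`u ≤ M (1 + t) ^ (-N / 2)` and `‖u(t)‖₁ ≤ M` are preserved (`DecayBound.picard_step`), since they make
the source `u ^ p` of size `M ^ p (1 + s) ^ (-N (p - 1) / 2)` in `L¹ ∩ L^∞`, which is integrable in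
time. Continuity follows by dominated convergence in space and in time.
-/

noncomputable section

open MeasureTheory Set Filter Topology
open scoped ENNReal

namespace DynHeat

/-! ### The kernel `H` as a time integral of the normal flux -/

/-- The normal flux `-2 ∂_ρ Γ_N((z, ρ), s) = (ρ / s) Γ_N((z, ρ), s)` of the Gauss kernel. -/
def flux (N : ℕ) (z : Bd N) (ρ s : ℝ) : ℝ := gauss N (z, ρ) s * (ρ / s)

theorem flux_nonneg {N : ℕ} {z : Bd N} {ρ s : ℝ} (hρ : 0 ≤ ρ) (hs : 0 ≤ s) :
    0 ≤ flux N z ρ s :=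
  mul_nonneg (gauss_nonneg N _ hs) (div_nonneg hρ hs)

theorem flux_pos {N : ℕ} {z : Bd N} {ρ s : ℝ} (hρ : 0 < ρ) (hs : 0 < s) :
    0 < flux N z ρ s := by
  unfold flux gauss; positivity

theorem kernelH_eq (N : ℕ) (x y : Pt N) (t : ℝ) :
    kernelH N x y t = ∫ τ in (0 : ℝ)..t, flux N (x.1 - y.1) (x.2 + y.2 + τ) (t - τ) := by
  unfold kernelH
  rw [← intervalIntegral.integral_const_mul]
  refine intervalIntegral.integral_congr fun τ _ => ?_
  have h : x - reflect y + τ • eN N = (x.1 - y.1, x.2 + y.2 + τ) :=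
    Prod.ext (by simp [reflect, eN]) (by simp [reflect, eN])
  simp only [gaussDN_eq, h, flux]
  have h4 : -(2 * (x.2 + y.2 + τ)) / (4 * (t - τ)) = -((x.2 + y.2 + τ) / (t - τ)) / 2 := by
    rw [show (4 : ℝ) * (t - τ) = 2 * (2 * (t - τ)) by ring, ← mul_neg,
      mul_div_mul_left _ _ two_ne_zero, mul_comm (2 : ℝ) (t - τ), ← div_div, neg_div]
  rw [h4]
  ring

/-- The integral over a fixed interval, used for measurability and continuity in `t`. -/
theorem kernelH_eq_scaled (N : ℕ) (x y : Pt N) (t : ℝ) :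
    kernelH N x y t =
      t * ∫ θ in (0 : ℝ)..1, flux N (x.1 - y.1) (x.2 + y.2 + t * θ) (t - t * θ) := by
  have h := intervalIntegral.smul_integral_comp_mul_left (a := 0) (b := 1)
    (fun τ => flux N (x.1 - y.1) (x.2 + y.2 + τ) (t - τ)) t
  rw [kernelH_eq, ← smul_eq_mul, h]
  simp

theorem measurable_gauss (N : ℕ) : Measurable fun q : Pt N × ℝ => gauss N q.1 q.2 := by
  unfold gauss
  fun_prop

theorem measurable_flux (N : ℕ) :
    Measurable fun q : Bd N × ℝ × ℝ => flux N q.1 q.2.1 q.2.2 := by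
  unfold flux
  have h := (measurable_gauss N).comp
    (show Measurable fun q : Bd N × ℝ × ℝ => (((q.1, q.2.1) : Pt N), q.2.2) by fun_prop)
  exact h.mul (by fun_prop)

theorem measurable_kernelH (N : ℕ) :
    Measurable fun q : Pt N × Pt N × ℝ => kernelH N q.1 q.2.1 q.2.2 := by
  simp only [kernelH_eq_scaled, intervalIntegral.integral_of_le zero_le_one]
  refine Measurable.mul (by fun_prop) ?_
  refine (StronglyMeasurable.integral_prod_right (f := fun (q : Pt N × Pt N × ℝ) (θ : ℝ) =>
    flux N (q.1.1 - q.2.1.1) (q.1.2 + q.2.1.2 + q.2.2 * θ) (q.2.2 - q.2.2 * θ)) ?_).measurable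
  refine Measurable.stronglyMeasurable ?_
  exact (measurable_flux N).comp
    (show Measurable fun q : (Pt N × Pt N × ℝ) × ℝ =>
      (q.1.1.1 - q.1.2.1.1, q.1.1.2 + q.1.2.1.2 + q.1.2.2 * q.2, q.1.2.2 - q.1.2.2 * q.2) by
        fun_prop)

theorem measurable_kernelG (N : ℕ) :
    Measurable fun q : Pt N × Pt N × ℝ => kernelG N q.1 q.2.1 q.2.2 := by
  have h1 := (measurable_gauss N).comp
    (show Measurable fun q : Pt N × Pt N × ℝ => (q.1 - q.2.1, q.2.2) by fun_prop)
  have h2 := (measurable_gauss N).comp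
    (show Measurable fun q : Pt N × Pt N × ℝ => (q.1 - reflect q.2.1, q.2.2) by
      unfold reflect; fun_prop)
  exact (h1.sub h2).add (measurable_kernelH N)

theorem gauss_le {N : ℕ} (x : Pt N) {t : ℝ} (ht : 0 < t) : gauss N x t ≤ t ^ (-(N : ℝ) / 2) := by
  unfold gauss
  have h1 : (4 * Real.pi * t) ^ (-(N : ℝ) / 2) ≤ t ^ (-(N : ℝ) / 2) := by
    refine Real.rpow_le_rpow_of_nonpos ht ?_ ?_
    · nlinarith [Real.pi_gt_three]
    · have : (0 : ℝ) ≤ N := N.cast_nonneg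
      linarith
  have h2 : Real.exp (-(‖x.1‖ ^ 2 + x.2 ^ 2) / (4 * t)) ≤ 1 := by
    rw [Real.exp_le_one_iff]
    exact div_nonpos_of_nonpos_of_nonneg (by nlinarith [sq_nonneg ‖x.1‖, sq_nonneg x.2])
      (by positivity)
  calc _ ≤ t ^ (-(N : ℝ) / 2) * 1 := mul_le_mul h1 h2 (by positivity) (by positivity)
    _ = _ := mul_one _

theorem exp_neg_le_rpow {k z : ℝ} (hk : 0 < k) (hz : 0 < z) : Real.exp (-z) ≤ (z / k) ^ (-k) := by
  rw [Real.rpow_neg (by positivity), Real.exp_neg]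
  refine inv_anti₀ (by positivity) ?_
  calc (z / k) ^ k ≤ (Real.exp (z / k)) ^ k :=
        Real.rpow_le_rpow (by positivity) (by linarith [Real.add_one_le_exp (z / k)]) hk.le
    _ = Real.exp z := by rw [← Real.exp_mul]; congr 1; field_simp

/-- A uniform constant in the flux estimate `flux_le`. -/
def fluxConst (N : ℕ) : ℝ :=
  2 * (2 ^ (((N : ℝ) + 1) / 2) + (32 * (((N : ℝ) + 1) / 2)) ^ (((N : ℝ) + 1) / 2))

theorem fluxConst_pos (N : ℕ) : 0 < fluxConst N := by unfold fluxConst; positivity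

theorem flux_le_exp {N : ℕ} (z : Bd N) {ρ s τ : ℝ} (hs : 0 < s) (hτ : 0 ≤ τ) (hρ : τ ≤ ρ) :
    flux N z ρ s ≤ 2 * (s ^ (-(((N : ℝ) + 1) / 2)) * Real.exp (-(τ ^ 2 / (8 * s)))) := by
  have hρ0 : 0 ≤ ρ := hτ.trans hρ
  have hsq : 0 < √s := Real.sqrt_pos.2 hs
  have hss : √s ^ 2 = s := Real.sq_sqrt hs.le
  have h1 : (4 * Real.pi * s) ^ (-(N : ℝ) / 2) ≤ s ^ (-(N : ℝ) / 2) := by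
    refine Real.rpow_le_rpow_of_nonpos hs (by nlinarith [Real.pi_gt_three]) ?_
    have : (0 : ℝ) ≤ N := N.cast_nonneg
    linarith
  have h2 : Real.exp (-(‖z‖ ^ 2 + ρ ^ 2) / (4 * s)) ≤
      Real.exp (-(τ ^ 2 / (8 * s))) * Real.exp (-(ρ ^ 2 / (8 * s))) := by
    rw [← Real.exp_add, Real.exp_le_exp, ← neg_add, ← add_div, neg_div, neg_le_neg_iff,
      div_le_div_iff₀ (by positivity) (by positivity)]
    nlinarith [mul_nonneg (sq_nonneg ‖z‖) hs.le, mul_nonneg (sub_nonneg.2 hρ) hs.le,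
      mul_nonneg (mul_nonneg (sub_nonneg.2 hρ) (add_nonneg hρ0 hτ)) hs.le]
  have h3 : Real.exp (-(ρ ^ 2 / (8 * s))) * (ρ / s) ≤ 2 * s ^ (-(1 : ℝ) / 2) := by
    have e1 : s ^ (-(1 : ℝ) / 2) = (√s)⁻¹ := by
      rw [neg_div, Real.rpow_neg hs.le, Real.sqrt_eq_rpow]
    have e2 : ρ ^ 2 / (8 * s) = (ρ / √s) ^ 2 / 8 := by
      rw [div_pow, hss]; field_simp
    have e3 : ρ / s = (ρ / √s) * (√s)⁻¹ := by
      rw [← div_eq_mul_inv, div_div, ← sq, hss]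
    rw [e1, e2, e3]
    set w := ρ / √s
    have hw : w ≤ 2 * Real.exp (w ^ 2 / 8) := by
      nlinarith [Real.add_one_le_exp (w ^ 2 / 8), sq_nonneg (w - 2)]
    rw [← mul_assoc]
    refine mul_le_mul_of_nonneg_right ?_ (by positivity)
    rw [Real.exp_neg, inv_mul_le_iff₀ (Real.exp_pos _)]
    linarith
  have e4 : s ^ (-(((N : ℝ) + 1) / 2)) = s ^ (-(N : ℝ) / 2) * s ^ (-(1 : ℝ) / 2) := by
    rw [← Real.rpow_add hs]; congr 1; ring
  unfold flux gauss
  calc _ ≤ (s ^ (-(N : ℝ) / 2) * (Real.exp (-(τ ^ 2 / (8 * s))) * Real.exp (-(ρ ^ 2 / (8 * s)))))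
        * (ρ / s) := by gcongr
    _ = s ^ (-(N : ℝ) / 2) * Real.exp (-(τ ^ 2 / (8 * s))) *
        (Real.exp (-(ρ ^ 2 / (8 * s))) * (ρ / s)) := by ring
    _ ≤ s ^ (-(N : ℝ) / 2) * Real.exp (-(τ ^ 2 / (8 * s))) * (2 * s ^ (-(1 : ℝ) / 2)) := by gcongr
    _ = _ := by rw [e4]; ring

/-- With `t = s + τ`: if `s ≥ t / 2` the flux is a Gaussian in `τ` of width `√t`; if `s ≤ t / 2` then
`ρ ≥ t / 2`, and the exponential compensates any negative power of `s`. -/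
theorem flux_le {N : ℕ} (z : Bd N) {ρ s τ : ℝ} (hs : 0 < s) (hτ : 0 ≤ τ) (hρ : τ ≤ ρ) :
    flux N z ρ s ≤ fluxConst N * ((s + τ) ^ (-(((N : ℝ) + 1) / 2)) *
      Real.exp (-(1 / (8 * (s + τ))) * τ ^ 2) + (s + τ) ^ (-((N : ℝ) + 1))) := by
  refine (flux_le_exp z hs hτ hρ).trans ?_
  set k : ℝ := ((N : ℝ) + 1) / 2 with hk
  have hk0 : 0 < k := by positivity
  have ht : 0 < s + τ := by positivity
  unfold fluxConst
  rw [← hk, mul_assoc 2]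
  refine mul_le_mul_of_nonneg_left ?_ two_pos.le
  have n1 : 0 ≤ (s + τ) ^ (-k) * Real.exp (-(1 / (8 * (s + τ))) * τ ^ 2) := by positivity
  have n2 : 0 ≤ (s + τ) ^ (-((N : ℝ) + 1)) := by positivity
  have n3 : (0 : ℝ) ≤ 2 ^ k := by positivity
  have n4 : (0 : ℝ) ≤ (32 * k) ^ k := by positivity
  rcases le_total τ s with h | h
  · have h1 : s ^ (-k) ≤ 2 ^ k * (s + τ) ^ (-k) := by
      calc s ^ (-k) ≤ ((s + τ) / 2) ^ (-k) :=
            Real.rpow_le_rpow_of_nonpos (by positivity) (by linarith) (by linarith)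
        _ = _ := by
            rw [Real.div_rpow ht.le two_pos.le, Real.rpow_neg two_pos.le]
            field_simp
    have h2 : Real.exp (-(τ ^ 2 / (8 * s))) ≤ Real.exp (-(1 / (8 * (s + τ))) * τ ^ 2) := by
      rw [Real.exp_le_exp, neg_mul, neg_le_neg_iff, one_div, ← div_eq_inv_mul]
      exact div_le_div_of_nonneg_left (sq_nonneg τ) (by positivity) (by linarith)
    calc _ ≤ (2 ^ k * (s + τ) ^ (-k)) * Real.exp (-(1 / (8 * (s + τ))) * τ ^ 2) := by gcongr
      _ = 2 ^ k * ((s + τ) ^ (-k) * Real.exp (-(1 / (8 * (s + τ))) * τ ^ 2)) := by ring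
      _ ≤ _ := by nlinarith [mul_nonneg n3 n2, mul_nonneg n4 n1, mul_nonneg n4 n2]
  · have h1 : Real.exp (-(τ ^ 2 / (8 * s))) ≤ Real.exp (-((s + τ) ^ 2 / (32 * s))) := by
      rw [Real.exp_le_exp, neg_le_neg_iff, div_le_div_iff₀ (by positivity) (by positivity)]
      nlinarith [mul_nonneg hs.le (mul_nonneg (sub_nonneg.2 h) (by linarith : 0 ≤ 3 * τ + s))]
    have h2 : s ^ (-k) * Real.exp (-((s + τ) ^ 2 / (32 * s))) ≤
        (32 * k) ^ k * (s + τ) ^ (-((N : ℝ) + 1)) := by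
      calc _ ≤ s ^ (-k) * ((s + τ) ^ 2 / (32 * s) / k) ^ (-k) := by
            gcongr; exact exp_neg_le_rpow hk0 (by positivity)
        _ = _ := by
            rw [← Real.mul_rpow hs.le (by positivity),
              show s * ((s + τ) ^ 2 / (32 * s) / k) = (s + τ) ^ 2 / (32 * k) by field_simp,
              Real.div_rpow (by positivity) (by positivity),
              Real.rpow_neg (by positivity) (x := 32 * k), div_inv_eq_mul, mul_comm,
              ← Real.rpow_natCast (s + τ) 2, ← Real.rpow_mul ht.le]
            congr 2
            rw [hk]; push_cast; ring
    calc _ ≤ s ^ (-k) * Real.exp (-((s + τ) ^ 2 / (32 * s))) := by gcongr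
      _ ≤ _ := h2
      _ ≤ _ := by nlinarith [mul_nonneg n3 n2, mul_nonneg n4 n1, mul_nonneg n3 n1]

/-! ### Bounds for the kernel from above and from below -/

theorem flux_sub_le {N : ℕ} (z : Bd N) {r t τ : ℝ} (hr : 0 ≤ r) (hτ : 0 ≤ τ) (hτt : τ ≤ t) :
    flux N z (r + τ) (t - τ) ≤ fluxConst N * (t ^ (-(((N : ℝ) + 1) / 2)) *
      Real.exp (-(1 / (8 * t)) * τ ^ 2) + t ^ (-((N : ℝ) + 1))) := by
  rcases hτt.eq_or_lt with rfl | h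
  · have := fluxConst_pos N
    simp only [flux, sub_self, div_zero, mul_zero]
    positivity
  · have := flux_le z (sub_pos.2 h) hτ (by linarith : τ ≤ r + τ)
    simpa using this

theorem norm_flux_sub_le {N : ℕ} (z : Bd N) {r t τ : ℝ} (hr : 0 ≤ r) (hτ : 0 ≤ τ) (hτt : τ ≤ t) :
    ‖flux N z (r + τ) (t - τ)‖ ≤
      fluxConst N * (t ^ (-(((N : ℝ) + 1) / 2)) + t ^ (-((N : ℝ) + 1))) := by
  rw [Real.norm_of_nonneg (flux_nonneg (by linarith) (by linarith))]
  refine (flux_sub_le z hr hτ hτt).trans ?_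
  have ht : 0 ≤ t := hτ.trans hτt
  refine mul_le_mul_of_nonneg_left ?_ (fluxConst_pos N).le
  gcongr
  refine mul_le_of_le_one_right (by positivity) (Real.exp_le_one_iff.2 ?_)
  have : 0 ≤ 1 / (8 * t) * τ ^ 2 := by positivity
  linarith

theorem intervalIntegrable_flux {N : ℕ} (z : Bd N) {r t : ℝ} (hr : 0 ≤ r) (ht : 0 ≤ t) :
    IntervalIntegrable (fun τ => flux N z (r + τ) (t - τ)) volume 0 t := by
  rw [intervalIntegrable_iff_integrableOn_Icc_of_le ht]
  refine Measure.integrableOn_of_bounded (by simp)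
    ((measurable_flux N).comp
      (show Measurable fun τ : ℝ => (z, r + τ, t - τ) by fun_prop)).aestronglyMeasurable
    (M := fluxConst N * (t ^ (-(((N : ℝ) + 1) / 2)) + t ^ (-((N : ℝ) + 1)))) ?_
  exact (ae_restrict_iff' measurableSet_Icc).2
    (Eventually.of_forall fun τ hτ => norm_flux_sub_le z hr hτ.1 hτ.2)

theorem kernelH_le {N : ℕ} {x y : Pt N} (hx : x ∈ OmegaBar N) (hy : y ∈ OmegaBar N)
    {t : ℝ} (ht : 0 < t) :
    kernelH N x y t ≤ 6 * fluxConst N * (t ^ (-(N : ℝ) / 2) + t ^ (-(N : ℝ))) := by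
  have hr : 0 ≤ x.2 + y.2 := add_nonneg hx hy
  have hb : 0 < 1 / (8 * t) := by positivity
  have hg := integrable_exp_neg_mul_sq hb
  rw [kernelH_eq]
  have hint : IntervalIntegrable (fun τ => fluxConst N * (t ^ (-(((N : ℝ) + 1) / 2)) *
      Real.exp (-(1 / (8 * t)) * τ ^ 2) + t ^ (-((N : ℝ) + 1)))) volume 0 t :=
    ((hg.intervalIntegrable.const_mul _).add intervalIntegrable_const).const_mul _
  refine (intervalIntegral.integral_mono_on ht.le (intervalIntegrable_flux _ hr ht.le) hint
    fun τ hτ => flux_sub_le _ hr hτ.1 hτ.2).trans ?_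
  rw [intervalIntegral.integral_const_mul, intervalIntegral.integral_add
    (hg.intervalIntegrable.const_mul _) intervalIntegrable_const,
    intervalIntegral.integral_const_mul, intervalIntegral.integral_const, mul_comm 6, mul_assoc]
  refine mul_le_mul_of_nonneg_left ?_ (fluxConst_pos N).le
  have h1 : ∫ τ in (0 : ℝ)..t, Real.exp (-(1 / (8 * t)) * τ ^ 2) ≤ 6 * t ^ ((1 : ℝ) / 2) := by
    rw [intervalIntegral.integral_of_le ht.le]
    refine (setIntegral_le_integral hg (Eventually.of_forall fun τ => (Real.exp_pos _).le)).trans ?_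
    rw [integral_gaussian, ← Real.sqrt_eq_rpow, Real.sqrt_le_left (by positivity), mul_pow,
      Real.sq_sqrt ht.le, div_div_eq_mul_div, div_one]
    nlinarith [Real.pi_lt_four]
  have h2 : t ^ (-(((N : ℝ) + 1) / 2)) * t ^ ((1 : ℝ) / 2) = t ^ (-(N : ℝ) / 2) := by
    rw [← Real.rpow_add ht]; congr 1; ring
  have h3 : (t - 0) • t ^ (-((N : ℝ) + 1)) = t ^ (-(N : ℝ)) := by
    rw [sub_zero, smul_eq_mul]
    nth_rewrite 1 [← Real.rpow_one t]
    rw [← Real.rpow_add ht]; congr 1; ring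
  rw [h3, mul_add, ← h2]
  have h4 : 0 ≤ t ^ (-(((N : ℝ) + 1) / 2)) := by positivity
  have h5 : 0 ≤ t ^ (-(N : ℝ)) := by positivity
  nlinarith [mul_le_mul_of_nonneg_left h1 h4]

/-- A uniform constant in the upper bound `kernelG_le`. -/
def kernelConst (N : ℕ) : ℝ := 1 + 6 * fluxConst N

theorem kernelConst_pos (N : ℕ) : 0 < kernelConst N := by
  have := fluxConst_pos N
  unfold kernelConst; positivity

/-- For large `t` the kernel decays like the Gauss kernel. The term `t ^ (-N)` accounts for the
Poisson-like concentration of the kernel near the boundary at small times. -/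
theorem kernelG_le {N : ℕ} {x y : Pt N} (hx : x ∈ OmegaBar N) (hy : y ∈ OmegaBar N)
    {t : ℝ} (ht : 0 < t) :
    kernelG N x y t ≤ kernelConst N * (t ^ (-(N : ℝ) / 2) + t ^ (-(N : ℝ))) := by
  have h1 := gauss_le (x - y) ht
  have h2 := gauss_nonneg N (x - reflect y) ht.le
  have h3 := kernelH_le hx hy ht
  have h4 : 0 ≤ t ^ (-(N : ℝ)) := by positivity
  unfold kernelG kernelConst
  linarith

theorem gauss_sub_reflect_le {N : ℕ} {x y : Pt N} (hx : x ∈ OmegaBar N) (hy : y ∈ OmegaBar N)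
    {t : ℝ} (ht : 0 < t) : gauss N (x - reflect y) t ≤ gauss N (x - y) t := by
  have hx' : 0 ≤ x.2 := hx
  have hy' : 0 ≤ y.2 := hy
  unfold gauss
  refine mul_le_mul_of_nonneg_left (Real.exp_le_exp.2
    (div_le_div_of_nonneg_right ?_ (by positivity))) (by positivity)
  simp only [reflect, Prod.fst_sub, Prod.snd_sub]
  nlinarith [mul_nonneg hx' hy']

theorem kernelH_le_kernelG {N : ℕ} {x y : Pt N} (hx : x ∈ OmegaBar N) (hy : y ∈ OmegaBar N)
    {t : ℝ} (ht : 0 < t) : kernelH N x y t ≤ kernelG N x y t := by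
  have := gauss_sub_reflect_le hx hy ht
  unfold kernelG
  linarith

theorem kernelH_nonneg {N : ℕ} {x y : Pt N} (hx : x ∈ OmegaBar N) (hy : y ∈ OmegaBar N)
    {t : ℝ} (ht : 0 < t) : 0 ≤ kernelH N x y t := by
  have hr : 0 ≤ x.2 + y.2 := add_nonneg hx hy
  rw [kernelH_eq]
  exact intervalIntegral.integral_nonneg ht.le fun τ hτ =>
    flux_nonneg (by linarith [hτ.1]) (by linarith [hτ.2])

theorem kernelG_pos {N : ℕ} {x y : Pt N} (hx : x ∈ OmegaBar N) (hy : y ∈ OmegaBar N)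
    {t : ℝ} (ht : 0 < t) : 0 < kernelG N x y t := by
  have hr : 0 ≤ x.2 + y.2 := add_nonneg hx hy
  refine lt_of_lt_of_le ?_ (kernelH_le_kernelG hx hy ht)
  rw [kernelH_eq]
  exact intervalIntegral.intervalIntegral_pos_of_pos_on (intervalIntegrable_flux _ hr ht.le)
    (fun τ hτ => flux_pos (by linarith [hτ.1]) (by linarith [hτ.2])) ht

theorem kernelG_comm {N : ℕ} (x y : Pt N) (t : ℝ) : kernelG N x y t = kernelG N y x t := by
  have h1 : ‖x.1 - y.1‖ = ‖y.1 - x.1‖ := norm_sub_rev _ _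
  have h2 : kernelH N x y t = kernelH N y x t := by
    rw [kernelH_eq, kernelH_eq]
    simp only [flux, gauss, h1, add_comm x.2 y.2]
  unfold kernelG
  rw [h2]
  simp only [gauss, reflect, Prod.fst_sub, Prod.snd_sub, h1]
  ring_nf

theorem kernelH_lower {N : ℕ} {x y : Pt N} (hx : x ∈ OmegaBar N) (hy : y ∈ OmegaBar N)
    {t B : ℝ} (ht : 4 ≤ t) (hB : 0 ≤ B) (h1 : ‖x.1 - y.1‖ ≤ B * √t) (h2 : x.2 + y.2 ≤ B * √t) :
    1 / 4 * ((4 * Real.pi * t) ^ (-(N : ℝ) / 2) * Real.exp (-((B ^ 2 + (B + 1) ^ 2) / 2))) ≤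
      kernelH N x y t := by
  have ht0 : 0 < t := by linarith
  have hr : 0 ≤ x.2 + y.2 := add_nonneg hx hy
  have hss : √t ^ 2 = t := Real.sq_sqrt ht0.le
  have hs2 : 2 ≤ √t := Real.le_sqrt_of_sq_le (by linarith)
  have hst : √t ≤ t / 2 := by nlinarith
  rw [kernelH_eq]
  -- the times `τ ∈ [√t / 2, √t]` give a fixed fraction of the expected size
  have hsub := intervalIntegral.integral_mono_interval (a := √t / 2) (b := √t) (c := 0) (d := t)
    (f := fun τ => flux N (x.1 - y.1) (x.2 + y.2 + τ) (t - τ)) (μ := volume) (by positivity)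
    (by linarith) (by linarith)
    ((ae_restrict_iff' measurableSet_Ioc).2 (Eventually.of_forall fun τ hτ =>
      flux_nonneg (by linarith [hτ.1]) (by linarith [hτ.2]))) (intervalIntegrable_flux _ hr ht0.le)
  refine le_trans ?_ hsub
  set c := (4 * Real.pi * t) ^ (-(N : ℝ) / 2) * Real.exp (-((B ^ 2 + (B + 1) ^ 2) / 2)) with hc
  have hc0 : 0 ≤ c := by positivity
  have hcon : (1 : ℝ) / 4 * c = ∫ _ in (√t / 2)..√t, c * (√t / 2 / t) := by
    rw [intervalIntegral.integral_const, smul_eq_mul,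
      show (√t - √t / 2) * (c * (√t / 2 / t)) = 1 / 4 * c * (√t ^ 2 / t) by ring, hss,
      div_self ht0.ne', mul_one]
  rw [hcon]
  refine intervalIntegral.integral_mono_on (by linarith) intervalIntegrable_const
    ((intervalIntegrable_flux _ hr ht0.le).mono_set ?_) fun τ hτ => ?_
  · rw [uIcc_of_le (by linarith), uIcc_of_le ht0.le]
    exact Icc_subset_Icc (by linarith) (by linarith)
  have hτ1 : √t / 2 ≤ τ := hτ.1
  have hτ2 : τ ≤ √t := hτ.2
  have hs : 0 < t - τ := by linarith
  have hsl : t / 2 ≤ t - τ := by linarith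
  unfold flux gauss
  refine mul_le_mul ?_ ?_ (by positivity) (by positivity)
  · rw [hc]
    refine mul_le_mul ?_ ?_ (by positivity) (by positivity)
    · refine Real.rpow_le_rpow_of_nonpos (by positivity) ?_ ?_
      · nlinarith [Real.pi_pos]
      · have : (0 : ℝ) ≤ N := N.cast_nonneg
        linarith
    · rw [Real.exp_le_exp, neg_div, neg_le_neg_iff, div_le_iff₀ (by positivity)]
      have e1 : ‖x.1 - y.1‖ ^ 2 ≤ B ^ 2 * t := by
        calc _ ≤ (B * √t) ^ 2 := by gcongr
          _ = _ := by rw [mul_pow, hss]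
      have e2 : (x.2 + y.2 + τ) ^ 2 ≤ (B + 1) ^ 2 * t := by
        calc _ ≤ ((B + 1) * √t) ^ 2 := by
              refine pow_le_pow_left₀ (by linarith) ?_ 2
              linarith
          _ = _ := by rw [mul_pow, hss]
      calc _ ≤ (B ^ 2 + (B + 1) ^ 2) / 2 * (4 * (t / 2)) := by linarith
        _ ≤ _ := by gcongr
  · calc √t / 2 / t ≤ τ / t := by gcongr
      _ ≤ (x.2 + y.2 + τ) / t := by gcongr; linarith
      _ ≤ _ := by
        refine div_le_div_of_nonneg_left (by linarith) hs (by linarith)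

/-- In the parabolic region `|x'|, x_N, |y'|, y_N ≲ √t` the kernel is at least of the order
`t ^ (-N / 2)`, up to the boundary. The Dirichlet part of the kernel is too small for this. -/
theorem exists_kernelG_lower (N : ℕ) : ∃ c : ℝ, 0 < c ∧ ∀ x ∈ OmegaBar N, ∀ y ∈ OmegaBar N,
    ∀ t s : ℝ, 4 ≤ s → s ≤ t → t ≤ 2 * s → ‖x.1 - y.1‖ ≤ 4 * √t → x.2 + y.2 ≤ 4 * √t →
      c * t ^ (-(N : ℝ) / 2) ≤ kernelG N x y s := by
  refine ⟨1 / 4 * ((4 * Real.pi) ^ (-(N : ℝ) / 2) * Real.exp (-((8 ^ 2 + (8 + 1) ^ 2) / 2))),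
    by positivity, fun x hx y hy t s hs hst hts h1 h2 => ?_⟩
  have hs0 : 0 < s := by linarith
  have hsq : √t ≤ 2 * √s := by
    rw [Real.sqrt_le_left (by positivity), mul_pow, Real.sq_sqrt hs0.le]
    linarith
  refine le_trans ?_ ((kernelH_lower hx hy hs (by norm_num : (0 : ℝ) ≤ 8) (by linarith)
    (by linarith)).trans (kernelH_le_kernelG hx hy hs0))
  have h3 : t ^ (-(N : ℝ) / 2) ≤ s ^ (-(N : ℝ) / 2) := by
    refine Real.rpow_le_rpow_of_nonpos hs0 hst ?_
    have : (0 : ℝ) ≤ N := N.cast_nonneg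
    linarith
  rw [Real.mul_rpow (by positivity) hs0.le]
  calc _ = 1 / 4 * ((4 * Real.pi) ^ (-(N : ℝ) / 2) * t ^ (-(N : ℝ) / 2) *
        Real.exp (-((8 ^ 2 + (8 + 1) ^ 2) / 2))) := by ring
    _ ≤ _ := by gcongr

/-! ### Continuity and total mass of the kernel -/

theorem continuousAt_gauss {N : ℕ} {q : Pt N × ℝ} (hq : 0 < q.2) :
    ContinuousAt (fun q : Pt N × ℝ => gauss N q.1 q.2) q := by
  unfold gauss
  refine ContinuousAt.mul ?_ ?_
  · refine ContinuousAt.rpow_const (by fun_prop) (Or.inl (by positivity))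
  · refine Real.continuous_exp.continuousAt.comp (ContinuousAt.div (by fun_prop) (by fun_prop) ?_)
    positivity

theorem continuousAt_flux {N : ℕ} {q : Bd N × ℝ × ℝ} (hq : 0 < q.2.2) :
    ContinuousAt (fun q : Bd N × ℝ × ℝ => flux N q.1 q.2.1 q.2.2) q := by
  unfold flux
  refine ContinuousAt.mul ?_ (ContinuousAt.div (by fun_prop) (by fun_prop) hq.ne')
  exact ContinuousAt.comp (f := fun q : Bd N × ℝ × ℝ => (((q.1, q.2.1) : Pt N), q.2.2))
    (g := fun q : Pt N × ℝ => gauss N q.1 q.2) (continuousAt_gauss hq) (by fun_prop)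

theorem continuousOn_kernelH {N : ℕ} {y : Pt N} (hy : y ∈ OmegaBar N) :
    ContinuousOn (fun q : Pt N × ℝ => kernelH N q.1 y q.2) (OmegaBar N ×ˢ Ioi 0) := by
  rintro ⟨x₀, t₀⟩ ⟨hx₀, ht₀ : 0 < t₀⟩
  simp only [kernelH_eq_scaled]
  refine continuousWithinAt_snd.mul ?_
  have hN : (0 : ℝ) ≤ N := N.cast_nonneg
  refine intervalIntegral.continuousWithinAt_of_dominated_interval
    (bound := fun _ => fluxConst N *
      ((t₀ / 2) ^ (-(((N : ℝ) + 1) / 2)) + (t₀ / 2) ^ (-((N : ℝ) + 1)))) ?_ ?_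
    intervalIntegrable_const ?_
  · refine Eventually.of_forall fun q => Measurable.aestronglyMeasurable ?_
    exact (measurable_flux N).comp (show Measurable fun θ : ℝ =>
      (q.1.1 - y.1, q.1.2 + y.2 + q.2 * θ, q.2 - q.2 * θ) by fun_prop)
  · have h1 : ∀ᶠ q : Pt N × ℝ in 𝓝[OmegaBar N ×ˢ Ioi 0] (x₀, t₀), t₀ / 2 < q.2 :=
      nhdsWithin_le_nhds (continuousAt_snd.eventually (lt_mem_nhds (by simp; linarith)))
    filter_upwards [h1, self_mem_nhdsWithin] with q hq hqm
    refine Eventually.of_forall fun θ hθ => ?_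
    rw [uIoc_of_le zero_le_one] at hθ
    have hq0 : 0 < q.2 := hqm.2
    refine (norm_flux_sub_le _ (add_nonneg hqm.1 hy) (mul_nonneg hq0.le hθ.1.le)
      (mul_le_of_le_one_right hq0.le hθ.2)).trans ?_
    refine mul_le_mul_of_nonneg_left (add_le_add ?_ ?_) (fluxConst_pos N).le <;>
      exact Real.rpow_le_rpow_of_nonpos (by linarith) hq.le (by linarith)
  · filter_upwards [compl_mem_ae_iff.2 (measure_singleton (1 : ℝ))] with θ hθ1 hθ
    rw [uIoc_of_le zero_le_one] at hθ
    have hlt : θ < 1 := lt_of_le_of_ne hθ.2 hθ1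
    refine ContinuousAt.continuousWithinAt ?_
    refine ContinuousAt.comp (f := fun q : Pt N × ℝ =>
      (q.1.1 - y.1, q.1.2 + y.2 + q.2 * θ, q.2 - q.2 * θ))
      (g := fun q : Bd N × ℝ × ℝ => flux N q.1 q.2.1 q.2.2) (continuousAt_flux ?_) (by fun_prop)
    show 0 < t₀ - t₀ * θ
    nlinarith

theorem continuousOn_kernelG {N : ℕ} {y : Pt N} (hy : y ∈ OmegaBar N) :
    ContinuousOn (fun q : Pt N × ℝ => kernelG N q.1 y q.2) (OmegaBar N ×ˢ Ioi 0) := by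
  have h : ∀ z : Pt N, ContinuousOn (fun q : Pt N × ℝ => gauss N (q.1 - z) q.2)
      (OmegaBar N ×ˢ Ioi 0) := fun z q hq =>
    (ContinuousAt.comp (f := fun q : Pt N × ℝ => (q.1 - z, q.2))
      (g := fun q : Pt N × ℝ => gauss N q.1 q.2) (continuousAt_gauss hq.2)
      (by fun_prop)).continuousWithinAt
  exact ((h y).sub (h (reflect y))).add (continuousOn_kernelH hy)

/-- The one-dimensional Gauss kernel. -/
def gauss1 (ρ s : ℝ) : ℝ := (4 * Real.pi * s) ^ (-(1 : ℝ) / 2) * Real.exp (-ρ ^ 2 / (4 * s))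

theorem gauss1_nonneg (ρ : ℝ) {s : ℝ} (hs : 0 < s) : 0 ≤ gauss1 ρ s := by
  unfold gauss1; positivity

theorem measurable_gauss1 : Measurable fun q : ℝ × ℝ => gauss1 q.1 q.2 := by
  unfold gauss1; fun_prop

theorem lintegral_gaussian_eq {b : ℝ} (hb : 0 < b) :
    ∫⁻ w : ℝ, ENNReal.ofReal (Real.exp (-b * w ^ 2)) = ENNReal.ofReal (√(Real.pi / b)) := by
  rw [← ofReal_integral_eq_lintegral_ofReal (integrable_exp_neg_mul_sq hb)
    (Eventually.of_forall fun w => (Real.exp_pos _).le), integral_gaussian]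

theorem lintegral_gauss1 {s : ℝ} (hs : 0 < s) :
    ∫⁻ ρ : ℝ, ENNReal.ofReal (gauss1 ρ s) = 1 := by
  have h : ∀ ρ : ℝ, ENNReal.ofReal (gauss1 ρ s) =
      ENNReal.ofReal ((4 * Real.pi * s) ^ (-(1 : ℝ) / 2)) *
        ENNReal.ofReal (Real.exp (-(1 / (4 * s)) * ρ ^ 2)) := fun ρ => by
    rw [← ENNReal.ofReal_mul (by positivity)]
    unfold gauss1
    congr 3
    field_simp
  simp only [h]
  rw [lintegral_const_mul _ (by fun_prop), lintegral_gaussian_eq (by positivity),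
    ← ENNReal.ofReal_mul (by positivity), Real.sqrt_eq_rpow,
    show Real.pi / (1 / (4 * s)) = 4 * Real.pi * s by field_simp, ← Real.rpow_add (by positivity)]
  norm_num

theorem lintegral_tangential_gauss {N : ℕ} (hN : 1 ≤ N) (x : Bd N) {s : ℝ} (hs : 0 < s) :
    ∫⁻ y : Bd N, ENNReal.ofReal ((4 * Real.pi * s) ^ (-((N : ℝ) - 1) / 2) *
      Real.exp (-(1 / (4 * s)) * ‖x - y‖ ^ 2)) = 1 := by
  have hb : 0 < 1 / (4 * s) := by positivity
  rw [lintegral_sub_left_eq_self (fun z : Bd N => ENNReal.ofReal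
    ((4 * Real.pi * s) ^ (-((N : ℝ) - 1) / 2) * Real.exp (-(1 / (4 * s)) * ‖z‖ ^ 2))) x]
  have hi := GaussianFourier.integral_rexp_neg_mul_sq_norm (V := Bd N) hb
  have hpos : 0 < ∫ v : Bd N, Real.exp (-(1 / (4 * s)) * ‖v‖ ^ 2) := by rw [hi]; positivity
  have hint : Integrable fun v : Bd N => Real.exp (-(1 / (4 * s)) * ‖v‖ ^ 2) := by
    by_contra h
    rw [integral_undef h] at hpos
    exact lt_irrefl _ hpos
  rw [← ofReal_integral_eq_lintegral_ofReal (hint.const_mul _)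
    (Eventually.of_forall fun v => by positivity), integral_const_mul, hi,
    show Real.pi / (1 / (4 * s)) = 4 * Real.pi * s by field_simp, ← Real.rpow_add (by positivity),
    ← add_div]
  simp [Nat.cast_sub hN]

theorem gauss_eq_mul {N : ℕ} (z : Bd N) (ρ : ℝ) {s : ℝ} (hs : 0 < s) :
    gauss N (z, ρ) s = (4 * Real.pi * s) ^ (-((N : ℝ) - 1) / 2) *
      Real.exp (-(1 / (4 * s)) * ‖z‖ ^ 2) * gauss1 ρ s := by
  unfold gauss gauss1
  rw [show -(‖z‖ ^ 2 + ρ ^ 2) / (4 * s) = -(1 / (4 * s)) * ‖z‖ ^ 2 + -ρ ^ 2 / (4 * s) by ring,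
    Real.exp_add, show -(N : ℝ) / 2 = -((N : ℝ) - 1) / 2 + -(1 : ℝ) / 2 by ring,
    Real.rpow_add (by positivity)]
  ring

theorem lintegral_gauss {N : ℕ} (hN : 1 ≤ N) (x : Pt N) {s : ℝ} (hs : 0 < s) :
    ∫⁻ y : Pt N, ENNReal.ofReal (gauss N (x - y) s) = 1 := by
  have h : ∀ y : Pt N, ENNReal.ofReal (gauss N (x - y) s) =
      ENNReal.ofReal ((4 * Real.pi * s) ^ (-((N : ℝ) - 1) / 2) *
        Real.exp (-(1 / (4 * s)) * ‖x.1 - y.1‖ ^ 2)) * ENNReal.ofReal (gauss1 (x.2 - y.2) s) :=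
    fun y => by
      rw [← ENNReal.ofReal_mul (by positivity), ← gauss_eq_mul _ _ hs]; rfl
  simp only [h]
  have m1 : Measurable fun y : Bd N => ENNReal.ofReal
      ((4 * Real.pi * s) ^ (-((N : ℝ) - 1) / 2) * Real.exp (-(1 / (4 * s)) * ‖x.1 - y‖ ^ 2)) := by
    fun_prop
  have m2 : Measurable fun y : ℝ => ENNReal.ofReal (gauss1 (x.2 - y) s) :=
    (measurable_gauss1.comp (show Measurable fun y : ℝ => (x.2 - y, s) by fun_prop)).ennreal_ofReal
  rw [Measure.volume_eq_prod, lintegral_prod_mul m1.aemeasurable m2.aemeasurable,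
    lintegral_tangential_gauss hN _ hs, one_mul,
    lintegral_sub_left_eq_self (fun z => ENNReal.ofReal (gauss1 z s)), lintegral_gauss1 hs]

theorem lintegral_flux_boundary {N : ℕ} (hN : 1 ≤ N) (x : Bd N) (ρ : ℝ) {s : ℝ}
    (hs : 0 < s) : ∫⁻ y : Bd N, ENNReal.ofReal (flux N (x - y) ρ s) =
      ENNReal.ofReal (gauss1 ρ s * (ρ / s)) := by
  have h : ∀ y : Bd N, ENNReal.ofReal (flux N (x - y) ρ s) =
      ENNReal.ofReal ((4 * Real.pi * s) ^ (-((N : ℝ) - 1) / 2) *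
        Real.exp (-(1 / (4 * s)) * ‖x - y‖ ^ 2)) * ENNReal.ofReal (gauss1 ρ s * (ρ / s)) :=
    fun y => by
      rw [← ENNReal.ofReal_mul (by positivity), ← mul_assoc, ← gauss_eq_mul _ _ hs]; rfl
  simp only [h]
  rw [lintegral_mul_const _ (by fun_prop), lintegral_tangential_gauss hN _ hs, one_mul]

theorem lintegral_normal_flux {ρ s : ℝ} (hs : 0 < s) (hρ : 0 ≤ ρ) :
    ∫⁻ r in Ioi (0 : ℝ), ENNReal.ofReal (gauss1 (ρ + r) s * ((ρ + r) / s)) =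
      ENNReal.ofReal (2 * gauss1 ρ s) := by
  have hd : ∀ r : ℝ, HasDerivAt (fun r => -(2 * gauss1 (ρ + r) s))
      (gauss1 (ρ + r) s * ((ρ + r) / s)) r := fun r => by
    have h1 : HasDerivAt (fun r : ℝ => -(ρ + r) ^ 2 / (4 * s)) (-(2 * (ρ + r)) / (4 * s)) r := by
      simpa using ((((hasDerivAt_id r).const_add ρ).pow 2).neg).div_const (4 * s)
    convert! (((h1.exp).const_mul ((4 * Real.pi * s) ^ (-(1 : ℝ) / 2))).const_mul 2).neg using 1
    unfold gauss1
    field_simp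
    ring
  have hnn : ∀ r ∈ Ioi (0 : ℝ), 0 ≤ gauss1 (ρ + r) s * ((ρ + r) / s) := fun r hr =>
    mul_nonneg (gauss1_nonneg _ hs) (div_nonneg (add_nonneg hρ (le_of_lt hr)) hs.le)
  have hlim : Tendsto (fun r => -(2 * gauss1 (ρ + r) s)) atTop (𝓝 0) := by
    have h1 : Tendsto (fun r : ℝ => -(ρ + r) ^ 2 / (4 * s)) atTop atBot := by
      refine Tendsto.atBot_div_const (by positivity) ?_
      exact tendsto_neg_atTop_atBot.comp ((tendsto_pow_atTop two_ne_zero).comp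
        (tendsto_atTop_add_const_left _ ρ tendsto_id))
    have h2 := ((Real.tendsto_exp_atBot.comp h1).const_mul
      ((4 * Real.pi * s) ^ (-(1 : ℝ) / 2))).const_mul 2 |>.neg
    simpa [gauss1] using h2
  have hI := integrableOn_Ioi_deriv_of_nonneg' (fun r _ => hd r) hnn hlim
  rw [← ofReal_integral_eq_lintegral_ofReal hI
    ((ae_restrict_iff' measurableSet_Ioi).2 (Eventually.of_forall hnn)),
    integral_Ioi_of_hasDerivAt_of_nonneg' (fun r _ => hd r) hnn hlim]
  simp

/-- The total flux through the boundary up to time `t`: with `z(τ) = (r + τ) / (2 √(t - τ))` the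
integrand is `(2 / √π) z'(τ) exp (-z(τ)²)`, the density of a complementary error function. -/
theorem lintegral_flux_time_le {r t : ℝ} (hr : 0 ≤ r) :
    ∫⁻ τ in Ioo 0 t, ENNReal.ofReal
      (gauss1 (r + τ) (t - τ) * (2 + (r + τ) / (t - τ))) ≤ 2 := by
  set f : ℝ → ℝ := fun τ => (r + τ) / (2 * √(t - τ)) with hf
  set f' : ℝ → ℝ := fun τ => (1 / 2 + (r + τ) / (4 * (t - τ))) / √(t - τ) with hf'
  have hd : ∀ τ ∈ Ioo 0 t, HasDerivWithinAt f (f' τ) (Ioo 0 t) τ := fun τ hτ => by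
    have hs : 0 < t - τ := sub_pos.2 hτ.2
    have hq : 0 < √(t - τ) := Real.sqrt_pos.2 hs
    have h1 : HasDerivAt (fun τ => √(t - τ)) (-1 / (2 * √(t - τ))) τ := by
      simpa using ((hasDerivAt_id τ).const_sub t).sqrt hs.ne'
    have h2 := ((hasDerivAt_id τ).const_add r).div (h1.const_mul 2) (by positivity)
    refine HasDerivAt.hasDerivWithinAt ?_
    convert! h2 using 1
    have hss : √(t - τ) ^ 2 = t - τ := Real.sq_sqrt hs.le
    simp only [hf', id]
    generalize √(t - τ) = w at *
    rw [← hss]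
    field_simp
    ring
  have hmono : StrictMonoOn f (Ioo 0 t) := fun a ha b hb hab => by
    have hs : 0 < √(t - b) := Real.sqrt_pos.2 (sub_pos.2 hb.2)
    have hle : √(t - b) ≤ √(t - a) := Real.sqrt_le_sqrt (by linarith)
    have ha0 : 0 < a := ha.1
    have hb0 : 0 < b := hb.1
    simp only [hf]
    exact div_lt_div₀ (by linarith) (by linarith) (by linarith) (by positivity)
  have hpi : 0 < √Real.pi := Real.sqrt_pos.2 Real.pi_pos
  have heq : ∀ τ ∈ Ioo 0 t, ENNReal.ofReal (gauss1 (r + τ) (t - τ) * (2 + (r + τ) / (t - τ))) =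
      ENNReal.ofReal (2 / √Real.pi) *
        (ENNReal.ofReal |f' τ| * ENNReal.ofReal (Real.exp (-1 * f τ ^ 2))) := fun τ hτ => by
    have hs : 0 < t - τ := sub_pos.2 hτ.2
    have hτ0 : 0 < τ := hτ.1
    have hf0 : 0 ≤ f' τ := by simp only [hf']; positivity
    rw [abs_of_nonneg hf0, ← ENNReal.ofReal_mul hf0, ← ENNReal.ofReal_mul (by positivity)]
    congr 1
    have hq : 0 < √(t - τ) := Real.sqrt_pos.2 hs
    have hss : √(t - τ) ^ 2 = t - τ := Real.sq_sqrt hs.le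
    have e1 : (4 * Real.pi * (t - τ)) ^ (-(1 : ℝ) / 2) = (2 * √Real.pi * √(t - τ))⁻¹ := by
      rw [neg_div, Real.rpow_neg (by positivity), ← Real.sqrt_eq_rpow,
        Real.sqrt_mul (by positivity), Real.sqrt_mul (by norm_num),
        show (4 : ℝ) = 2 ^ 2 by norm_num, Real.sqrt_sq (by norm_num)]
    have e2 : -1 * f τ ^ 2 = -(r + τ) ^ 2 / (4 * (t - τ)) := by
      simp only [hf]
      rw [div_pow, mul_pow, hss]
      ring
    rw [e2]
    unfold gauss1
    rw [e1]
    simp only [hf']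
    field_simp
    ring
  rw [setLIntegral_congr_fun measurableSet_Ioo heq, lintegral_const_mul' _ _ ENNReal.ofReal_ne_top,
    ← lintegral_image_eq_lintegral_abs_deriv_mul measurableSet_Ioo hd hmono.injOn
      (fun w => ENNReal.ofReal (Real.exp (-1 * w ^ 2)))]
  refine (mul_le_mul_right (setLIntegral_le_lintegral _ _) _).trans ?_
  rw [lintegral_gaussian_eq one_pos, ← ENNReal.ofReal_mul (by positivity), div_one,
    div_mul_cancel₀ _ hpi.ne']
  simp

theorem measurableSet_Omega (N : ℕ) : MeasurableSet (Omega N) :=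
  measurableSet_lt measurable_const measurable_snd

theorem Omega_subset (N : ℕ) : Omega N ⊆ OmegaBar N := fun x (hx : 0 < x.2) => hx.le

theorem bdPt_mem {N : ℕ} (y : Bd N) : bdPt y ∈ OmegaBar N := le_refl (0 : ℝ)

theorem volume_restrict_Omega (N : ℕ) : (volume : Measure (Pt N)).restrict (Omega N) =
    (volume : Measure (Bd N)).prod ((volume : Measure ℝ).restrict (Ioi 0)) := by
  have h : Omega N = univ ×ˢ Ioi 0 := by ext x; simp [Omega]
  rw [h, Measure.volume_eq_prod, ← Measure.prod_restrict, Measure.restrict_univ]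

theorem measurable_flux_comp {N : ℕ} (x : Pt N) (t : ℝ) : Measurable fun q : Pt N × ℝ =>
    ENNReal.ofReal (flux N (x.1 - q.1.1) (x.2 + q.1.2 + q.2) (t - q.2)) :=
  ((measurable_flux N).comp (show Measurable fun q : Pt N × ℝ =>
    (x.1 - q.1.1, x.2 + q.1.2 + q.2, t - q.2) by fun_prop)).ennreal_ofReal

theorem ofReal_kernelH {N : ℕ} {x y : Pt N} (hx : x ∈ OmegaBar N) (hy : y ∈ OmegaBar N)
    {t : ℝ} (ht : 0 < t) : ENNReal.ofReal (kernelH N x y t) =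
      ∫⁻ τ in Ioo 0 t, ENNReal.ofReal (flux N (x.1 - y.1) (x.2 + y.2 + τ) (t - τ)) := by
  have hr : 0 ≤ x.2 + y.2 := add_nonneg hx hy
  have hi := intervalIntegrable_flux (x.1 - y.1) hr ht.le
  rw [intervalIntegrable_iff_integrableOn_Ioo_of_le ht.le] at hi
  rw [kernelH_eq, intervalIntegral.integral_of_le ht.le, integral_Ioc_eq_integral_Ioo,
    ofReal_integral_eq_lintegral_ofReal hi]
  exact (ae_restrict_iff' measurableSet_Ioo).2 (Eventually.of_forall fun τ hτ =>
    flux_nonneg (by linarith [hτ.1]) (by linarith [hτ.2]))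

theorem lintegral_flux_Omega {N : ℕ} (hN : 1 ≤ N) (x : Bd N) {ρ s : ℝ} (hρ : 0 ≤ ρ)
    (hs : 0 < s) :
    ∫⁻ y in Omega N, ENNReal.ofReal (flux N (x - y.1) (ρ + y.2) s) =
      ENNReal.ofReal (2 * gauss1 ρ s) := by
  have hm : Measurable fun y : Pt N => ENNReal.ofReal (flux N (x - y.1) (ρ + y.2) s) :=
    ((measurable_flux N).comp (show Measurable fun y : Pt N =>
      (x - y.1, ρ + y.2, s) by fun_prop)).ennreal_ofReal
  rw [volume_restrict_Omega, lintegral_prod_symm _ hm.aemeasurable, ← lintegral_normal_flux hs hρ]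
  refine lintegral_congr fun r => ?_
  exact lintegral_flux_boundary hN x (ρ + r) hs

/-- The kernel `H` distributes mass at most `2` over the half-space and its boundary. -/
theorem lintegral_kernelH_le {N : ℕ} (hN : 1 ≤ N) {x : Pt N} (hx : x ∈ OmegaBar N)
    {t : ℝ} (ht : 0 < t) :
    (∫⁻ y in Omega N, ENNReal.ofReal (kernelH N x y t)) +
      ∫⁻ y : Bd N, ENNReal.ofReal (kernelH N x (bdPt y) t) ≤ 2 := by
  have hx' : 0 ≤ x.2 := hx
  have h1 : ∫⁻ y in Omega N, ENNReal.ofReal (kernelH N x y t) =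
      ∫⁻ τ in Ioo 0 t, ENNReal.ofReal (2 * gauss1 (x.2 + τ) (t - τ)) := by
    rw [setLIntegral_congr_fun (measurableSet_Omega N)
      fun y hy => ofReal_kernelH hx (Omega_subset N hy) ht,
      lintegral_lintegral_swap (measurable_flux_comp x t).aemeasurable]
    refine setLIntegral_congr_fun measurableSet_Ioo fun τ hτ => ?_
    rw [← lintegral_flux_Omega hN x.1 (add_nonneg hx' hτ.1.le) (sub_pos.2 hτ.2)]
    simp only [add_right_comm]
  have h2 : ∫⁻ y : Bd N, ENNReal.ofReal (kernelH N x (bdPt y) t) =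
      ∫⁻ τ in Ioo 0 t, ENNReal.ofReal (gauss1 (x.2 + τ) (t - τ) * ((x.2 + τ) / (t - τ))) := by
    rw [lintegral_congr fun y => ofReal_kernelH hx (bdPt_mem y) ht,
      lintegral_lintegral_swap (f := fun (y : Bd N) (τ : ℝ) => ENNReal.ofReal
        (flux N (x.1 - (bdPt y).1) (x.2 + (bdPt y).2 + τ) (t - τ)))
        ((measurable_flux_comp x t).comp (show Measurable
          fun q : Bd N × ℝ => (bdPt q.1, q.2) by unfold bdPt; fun_prop)).aemeasurable]
    refine setLIntegral_congr_fun measurableSet_Ioo fun τ hτ => ?_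
    rw [← lintegral_flux_boundary hN x.1 (x.2 + τ) (sub_pos.2 hτ.2)]
    simp [bdPt]
  have hm : Measurable fun τ : ℝ => ENNReal.ofReal (2 * gauss1 (x.2 + τ) (t - τ)) :=
    ((measurable_gauss1.comp (show Measurable fun τ : ℝ => (x.2 + τ, t - τ) by
      fun_prop)).const_mul 2).ennreal_ofReal
  rw [h1, h2, ← lintegral_add_left hm]
  refine le_trans (le_of_eq ?_) (lintegral_flux_time_le (t := t) hx')
  refine setLIntegral_congr_fun measurableSet_Ioo fun τ hτ => ?_
  have hs : 0 < t - τ := sub_pos.2 hτ.2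
  have hτ0 : 0 < τ := hτ.1
  have hg := gauss1_nonneg (x.2 + τ) hs
  rw [← ENNReal.ofReal_add (by positivity) (by positivity)]
  congr 1
  ring

/-- The kernel has bounded total mass (the exact value is `1`). -/
theorem lintegral_kernelG_le {N : ℕ} (hN : 1 ≤ N) {x : Pt N} (hx : x ∈ OmegaBar N)
    {t : ℝ} (ht : 0 < t) :
    (∫⁻ y in Omega N, ENNReal.ofReal (kernelG N x y t)) +
      ∫⁻ y : Bd N, ENNReal.ofReal (kernelG N x (bdPt y) t) ≤ 3 := by
  have hm : Measurable fun y : Pt N => ENNReal.ofReal (gauss N (x - y) t) :=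
    ((measurable_gauss N).comp (show Measurable fun y : Pt N => (x - y, t) by
      fun_prop)).ennreal_ofReal
  have h1 : ∫⁻ y in Omega N, ENNReal.ofReal (kernelG N x y t) ≤
      1 + ∫⁻ y in Omega N, ENNReal.ofReal (kernelH N x y t) := by
    rw [← lintegral_gauss hN x ht]
    refine le_trans ?_ (add_le_add_left (setLIntegral_le_lintegral (Omega N) _) _)
    rw [← lintegral_add_left hm]
    refine setLIntegral_mono' (measurableSet_Omega N) fun y hy => ?_
    rw [← ENNReal.ofReal_add (gauss_nonneg N _ ht.le)
      (kernelH_nonneg hx (Omega_subset N hy) ht)]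
    refine ENNReal.ofReal_le_ofReal ?_
    have := gauss_nonneg N (x - reflect y) ht.le
    unfold kernelG
    linarith
  have h2 : ∀ y : Bd N, kernelG N x (bdPt y) t = kernelH N x (bdPt y) t := fun y => by
    unfold kernelG
    simp [bdPt, reflect]
  simp only [h2]
  calc _ ≤ 1 + (∫⁻ y in Omega N, ENNReal.ofReal (kernelH N x y t)) +
        ∫⁻ y : Bd N, ENNReal.ofReal (kernelH N x (bdPt y) t) := by gcongr
    _ ≤ 1 + 2 := by rw [add_assoc]; gcongr; exact lintegral_kernelH_le hN hx ht
    _ = 3 := by norm_num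

/-! ### Nonexistence up to the critical exponent -/

/-- The cylinder `|y'| ≤ R`, `R ≤ y_N ≤ 2R`, which lies at distance `R` from the boundary. -/
def core (N : ℕ) (R : ℝ) : Set (Pt N) := Metric.closedBall (0 : Bd N) R ×ˢ Icc R (2 * R)

theorem isCompact_core (N : ℕ) (R : ℝ) : IsCompact (core N R) :=
  (isCompact_closedBall _ _).prod isCompact_Icc

theorem measurableSet_core (N : ℕ) (R : ℝ) : MeasurableSet (core N R) :=
  (isCompact_core N R).measurableSet

theorem mem_core {N : ℕ} {R : ℝ} {y : Pt N} :
    y ∈ core N R ↔ ‖y.1‖ ≤ R ∧ R ≤ y.2 ∧ y.2 ≤ 2 * R := by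
  simp [core, mem_prod]

theorem convex_core (N : ℕ) (R : ℝ) : Convex ℝ (core N R) :=
  (convex_closedBall _ _).prod (convex_Icc _ _)

theorem core_subset_Omega {N : ℕ} {R : ℝ} (hR : 0 < R) : core N R ⊆ Omega N := fun _ hy =>
  lt_of_lt_of_le hR (mem_core.1 hy).2.1

/-- The volume of the cylinder `core N 1`. -/
def coreVol (N : ℕ) : ℝ := (volume (core N 1)).toReal

theorem ofReal_coreVol (N : ℕ) : ENNReal.ofReal (coreVol N) = volume (core N 1) :=
  ENNReal.ofReal_toReal (isCompact_core N 1).measure_lt_top.ne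

theorem coreVol_pos (N : ℕ) : 0 < coreVol N := by
  refine ENNReal.toReal_pos ?_ (isCompact_core N 1).measure_lt_top.ne
  unfold core
  rw [Measure.volume_eq_prod, Measure.prod_prod]
  refine mul_ne_zero (Metric.measure_closedBall_pos volume _ one_pos).ne' ?_
  rw [Real.volume_Icc]
  norm_num

theorem volume_core {N : ℕ} (hN : 1 ≤ N) {R : ℝ} (hR : 0 < R) :
    volume (core N R) = ENNReal.ofReal (R ^ N * coreVol N) := by
  have h := Measure.addHaar_closedBall' (volume : Measure (Bd N)) 0 hR.le
  rw [finrank_euclideanSpace_fin] at h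
  rw [ENNReal.ofReal_mul (by positivity), ofReal_coreVol]
  unfold core
  rw [Measure.volume_eq_prod, Measure.prod_prod, Measure.prod_prod, h, Real.volume_Icc,
    Real.volume_Icc, show 2 * R - R = R by ring, show (2 : ℝ) * 1 - 1 = 1 by norm_num,
    ENNReal.ofReal_one, mul_one, mul_right_comm, ← ENNReal.ofReal_mul (by positivity), ← pow_succ,
    Nat.sub_add_cancel hN]

/-- Away from the boundary the kernel controls the Gauss kernel. -/
theorem gauss_le_kernelG {N : ℕ} {x y : Pt N} {R s : ℝ} (hR : 0 < R) (hx : R ≤ x.2) (hy : R ≤ y.2)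
    (hs : 0 < s) (hsR : s ≤ R ^ 2) :
    (1 - Real.exp (-1)) * gauss N (x - y) s ≤ kernelG N x y s := by
  have h1 : gauss N (x - reflect y) s ≤ Real.exp (-1) * gauss N (x - y) s := by
    unfold gauss
    rw [mul_left_comm, ← Real.exp_add]
    refine mul_le_mul_of_nonneg_left (Real.exp_le_exp.2 ?_) (by positivity)
    simp only [reflect, Prod.fst_sub, Prod.snd_sub]
    rw [← sub_nonneg]
    have h2 : -1 + -(‖x.1 - y.1‖ ^ 2 + (x.2 - y.2) ^ 2) / (4 * s) -
        -(‖x.1 - y.1‖ ^ 2 + (x.2 - -y.2) ^ 2) / (4 * s) = (x.2 * y.2 - s) / s := by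
      field_simp
      ring
    rw [h2]
    refine div_nonneg ?_ hs.le
    nlinarith [mul_le_mul hx hy hR.le (hR.le.trans hx)]
  have h3 := kernelH_nonneg (x := x) (y := y) (hR.le.trans hx) (hR.le.trans hy) hs
  unfold kernelG
  linarith

/-- Up to the diffusion time `R²` a fixed fraction of the mass stays in `core N R`. The set
`x + (√s / R) (core N R - x)`, a subset by convexity, is already large enough. -/
theorem exists_lintegral_core_lower {N : ℕ} (hN : 1 ≤ N) : ∃ c : ℝ, 0 < c ∧
    ∀ R s : ℝ, 0 < R → 0 < s → s ≤ R ^ 2 → ∀ x ∈ core N R,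
      ENNReal.ofReal c ≤ ∫⁻ y in core N R, ENNReal.ofReal (kernelG N x y s) := by
  have he : 0 < 1 - Real.exp (-1) := by
    rw [sub_pos, Real.exp_lt_one_iff]
    norm_num
  refine ⟨(1 - Real.exp (-1)) * ((4 * Real.pi) ^ (-(N : ℝ) / 2) * Real.exp (-(5 / 4))) * coreVol N,
    mul_pos (mul_pos he (by positivity)) (coreVol_pos N), fun R s hR hs hsR x hx => ?_⟩
  set l := √s / R with hl
  have hl0 : 0 < l := div_pos (Real.sqrt_pos.2 hs) hR
  have hl1 : l ≤ 1 := by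
    rw [hl, div_le_one hR, Real.sqrt_le_left hR.le]
    exact hsR
  have hlR : l * R = √s := div_mul_cancel₀ _ hR.ne'
  have hl2 : l ^ 2 * R ^ 2 = s := by rw [← mul_pow, hlR, Real.sq_sqrt hs.le]
  set S := AffineMap.homothety x l '' core N R with hS
  have hmap : ∀ z : Pt N, AffineMap.homothety x l z = l • (z - x) + x := fun z => by
    simp [AffineMap.homothety_apply]
  have hSm : MeasurableSet S :=
    ((isCompact_core N R).image (AffineMap.homothety_continuous x l)).measurableSet
  have hSsub : S ⊆ core N R := by
    rintro _ ⟨z, hz, rfl⟩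
    rw [hmap, show l • (z - x) + x = (1 - l) • x + l • z by module]
    exact convex_core N R hx hz (by linarith) hl0.le (by ring)
  have : (volume : Measure (Pt N)).IsAddHaarMeasure := by
    rw [Measure.volume_eq_prod]
    infer_instance
  have hvol : volume S = ENNReal.ofReal (l ^ N * (R ^ N * coreVol N)) := by
    rw [hS, Measure.addHaar_image_homothety, volume_core hN hR, ENNReal.ofReal_mul (by positivity)
      (p := l ^ N)]
    congr 2
    rw [Module.finrank_prod, finrank_euclideanSpace_fin, Module.finrank_self,
      Nat.sub_add_cancel hN, abs_of_pos (by positivity)]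
  have hlow : ∀ y ∈ S, (1 - Real.exp (-1)) * ((4 * Real.pi * s) ^ (-(N : ℝ) / 2) *
      Real.exp (-(5 / 4))) ≤ kernelG N x y s := by
    intro y hy
    have hx2 := mem_core.1 hx
    refine le_trans ?_ (gauss_le_kernelG hR hx2.2.1 (mem_core.1 (hSsub hy)).2.1 hs hsR)
    obtain ⟨z, hz, rfl⟩ := hy
    have hz2 := mem_core.1 hz
    refine mul_le_mul_of_nonneg_left (mul_le_mul_of_nonneg_left (Real.exp_le_exp.2 ?_)
      (by positivity)) he.le
    have h1 : x - (AffineMap.homothety x l) z = l • (x - z) := by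
      rw [hmap]; module
    rw [h1, neg_div, neg_le_neg_iff, div_le_iff₀ (by positivity), Prod.smul_fst, Prod.smul_snd,
      norm_smul, Real.norm_of_nonneg hl0.le, smul_eq_mul, mul_pow, mul_pow, ← mul_add]
    have h2 : ‖(x - z).1‖ ≤ 2 * R := by
      rw [Prod.fst_sub]
      linarith [norm_sub_le x.1 z.1]
    have h3 : (x - z).2 ^ 2 ≤ R ^ 2 := by
      rw [Prod.snd_sub]
      refine sq_le_sq' ?_ ?_ <;> linarith
    have h4 : ‖(x - z).1‖ ^ 2 ≤ (2 * R) ^ 2 := pow_le_pow_left₀ (norm_nonneg _) h2 2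
    calc _ ≤ l ^ 2 * ((2 * R) ^ 2 + R ^ 2) := by gcongr
      _ = 5 / 4 * (4 * s) := by rw [← hl2]; ring
  calc _ = ENNReal.ofReal ((1 - Real.exp (-1)) * ((4 * Real.pi * s) ^ (-(N : ℝ) / 2) *
        Real.exp (-(5 / 4)))) * volume S := by
        rw [hvol, ← ENNReal.ofReal_mul (mul_nonneg he.le (by positivity))]
        congr 1
        have e1 : l ^ N * (R ^ N * coreVol N) = s ^ ((N : ℝ) / 2) * coreVol N := by
          rw [← mul_assoc, ← mul_pow, hlR, Real.sqrt_eq_rpow, ← Real.rpow_natCast,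
            ← Real.rpow_mul hs.le]
          congr 2
          ring
        have e2 : s ^ (-(N : ℝ) / 2) * s ^ ((N : ℝ) / 2) = 1 := by
          rw [← Real.rpow_add hs, neg_div, neg_add_cancel, Real.rpow_zero]
        rw [e1, Real.mul_rpow (by positivity) hs.le]
        linear_combination (-((1 - Real.exp (-1)) * ((4 * Real.pi) ^ (-(N : ℝ) / 2) *
          Real.exp (-(5 / 4))) * coreVol N)) * e2
    _ = ∫⁻ _ in S, ENNReal.ofReal ((1 - Real.exp (-1)) * ((4 * Real.pi * s) ^ (-(N : ℝ) / 2) *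
        Real.exp (-(5 / 4)))) := by rw [setLIntegral_const]
    _ ≤ ∫⁻ y in S, ENNReal.ofReal (kernelG N x y s) :=
        setLIntegral_mono' hSm fun y hy => ENNReal.ofReal_le_ofReal (hlow y hy)
    _ ≤ _ := lintegral_mono_set hSsub

theorem mem_times_top {t : ℝ} : t ∈ times ⊤ ↔ 0 < t := by
  simp [times, EReal.coe_lt_top]

/-- A solution dominates the contribution to the Duhamel integral of any family of sets on which it
is bounded below. -/
theorem IsSolution.duhamel_le {N : ℕ} {p : ℝ} {φi : Pt N → ℝ} {φb : Bd N → ℝ} {u : Pt N → ℝ → ℝ}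
    (hu : IsSolution N p φi φb ⊤ u) (hp : 0 ≤ p) {x : Pt N} (hx : x ∈ OmegaBar N) {a b t : ℝ}
    (ht : 0 < t) (ha : 0 ≤ a) (hb : b ≤ t) (S : ℝ → Set (Pt N)) (m : ℝ → ℝ)
    (hS : ∀ s ∈ Ioo a b, S s ⊆ Omega N) (hSm : ∀ s ∈ Ioo a b, MeasurableSet (S s))
    (hm0 : ∀ s ∈ Ioo a b, 0 ≤ m s) (hm : ∀ s ∈ Ioo a b, ∀ y ∈ S s, m s ≤ u y s) :
    ∫⁻ s in Ioo a b, (∫⁻ y in S s, ENNReal.ofReal (kernelG N x y (t - s))) *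
      ENNReal.ofReal (m s ^ p) ≤ ENNReal.ofReal (u x t) := by
  rw [hu.integral_eq x hx t (mem_times_top.2 ht)]
  refine le_trans ?_ le_add_self
  refine le_trans ?_ (lintegral_mono_set (Ioo_subset_Ioo ha hb))
  refine setLIntegral_mono' measurableSet_Ioo fun s hs => ?_
  rw [← lintegral_mul_const' _ _ ENNReal.ofReal_ne_top]
  unfold opG
  refine le_trans ?_ le_self_add
  refine le_trans ?_ (lintegral_mono_set (hS s hs))
  refine setLIntegral_mono' (hSm s hs) fun y hy => ?_
  have hG := kernelG_nonneg hx (Omega_subset N (hS s hs hy)) (sub_pos.2 (hs.2.trans_le hb))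
  rw [← ENNReal.ofReal_mul hG]
  exact ENNReal.ofReal_le_ofReal (mul_le_mul_of_nonneg_left
    (Real.rpow_le_rpow (hm0 s hs) (hm s hs y hy) hp) hG)

/-- `u` is at least `A t ^ (-N / 2)` in the parabolic region `|x'| ≤ 2√t`, `0 ≤ x_N ≤ 2√t`, for all
times `t ≥ T`. -/
def ParabolicLower (N : ℕ) (u : Pt N → ℝ → ℝ) (A T : ℝ) : Prop :=
  ∀ t, T ≤ t → ∀ x : Pt N, ‖x.1‖ ≤ 2 * √t → 0 ≤ x.2 → x.2 ≤ 2 * √t →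
    A * t ^ (-(N : ℝ) / 2) ≤ u x t

theorem const_mul_volume_le {N : ℕ} {S : Set (Pt N)} (hS : MeasurableSet S) {g : Pt N → ℝ} {c : ℝ}
    (h : ∀ y ∈ S, c ≤ g y) : ENNReal.ofReal c * volume S ≤ ∫⁻ y in S, ENNReal.ofReal (g y) := by
  rw [← setLIntegral_const]
  exact setLIntegral_mono' hS fun y hy => ENNReal.ofReal_le_ofReal (h y hy)

theorem exists_parabolicLower {N : ℕ} {p : ℝ} {φi : Pt N → ℝ} {φb : Bd N → ℝ}
    {u : Pt N → ℝ → ℝ} (hp : 0 ≤ p) (hu : IsGlobalPositiveSolution N p φi φb u) :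
    ∃ A : ℝ, 0 < A ∧ ParabolicLower N u A 8 := by
  obtain ⟨c, hc, hG⟩ := exists_kernelG_lower N
  have hsub : core N 1 ⊆ OmegaBar N := (core_subset_Omega one_pos).trans (Omega_subset N)
  have hne : (core N 1 ×ˢ Icc (1 : ℝ) 2).Nonempty :=
    ⟨((0, 1), 1), mem_core.2 ⟨by simp, le_rfl, by norm_num⟩, le_rfl, by norm_num⟩
  obtain ⟨⟨y₀, s₀⟩, hy₀, hmin⟩ := ((isCompact_core N 1).prod isCompact_Icc).exists_isMinOn hne
    (hu.1.continuousOn.mono (prod_mono hsub fun s hs =>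
      mem_times_top.2 (lt_of_lt_of_le one_pos hs.1)))
  set m := u y₀ s₀ with hm
  have hm0 : 0 < m := hu.2 y₀ (hsub hy₀.1) s₀ (lt_of_lt_of_le one_pos hy₀.2.1)
  have hv := coreVol_pos N
  refine ⟨c * coreVol N * m ^ p, by positivity, fun t ht x hx1 hx2 hx3 => ?_⟩
  have ht0 : 0 < t := by linarith
  have hux := (hu.2 x hx2 t ht0).le
  have h := hu.1.duhamel_le hp (x := x) hx2 (a := 1) (b := 2) ht0 zero_le_one (by linarith)
    (fun _ => core N 1) (fun _ => m) (fun _ _ => core_subset_Omega one_pos)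
    (fun _ _ => measurableSet_core N 1) (fun _ _ => hm0.le)
    (fun s hs y hy => hmin (show (y, s) ∈ core N 1 ×ˢ Icc (1 : ℝ) 2 from ⟨hy, hs.1.le, hs.2.le⟩))
  rw [← ENNReal.ofReal_le_ofReal_iff hux]
  refine le_trans ?_ h
  have hs2 : (2 : ℝ) ≤ √t := Real.le_sqrt_of_sq_le (by linarith)
  have hlow : ∀ s ∈ Ioo (1 : ℝ) 2, ENNReal.ofReal (c * t ^ (-(N : ℝ) / 2)) * volume (core N 1) ≤
      ∫⁻ y in core N 1, ENNReal.ofReal (kernelG N x y (t - s)) := fun s hs =>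
    const_mul_volume_le (measurableSet_core N 1) fun y hy => by
      have hy' := mem_core.1 hy
      have h1 := hs.1
      have h2 := hs.2
      refine hG x hx2 y (hsub hy) t (t - s) (by linarith) (by linarith) (by linarith) ?_ ?_
      · linarith [norm_sub_le x.1 y.1]
      · linarith
  refine le_trans (le_of_eq ?_) (setLIntegral_mono' measurableSet_Ioo fun s hs =>
    mul_le_mul_left (hlow s hs) (ENNReal.ofReal (m ^ p)))
  rw [setLIntegral_const, Real.volume_Ioo, ← ofReal_coreVol, ← ENNReal.ofReal_mul (by positivity),
    ← ENNReal.ofReal_mul (by positivity), ← ENNReal.ofReal_mul (by positivity)]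
  congr 1
  ring

/-- Up to the critical exponent `N (p - 1) / 2 ≤ 1`, so the Duhamel integral gains a factor
`∫ ds / s`: a lower bound of the order of the heat kernel improves to any multiple of it. -/
theorem ParabolicLower.improve {N : ℕ} (hN : 1 ≤ N) {p : ℝ} {φi : Pt N → ℝ} {φb : Bd N → ℝ}
    {u : Pt N → ℝ → ℝ} (hp : 0 ≤ p) (hpF : (N : ℝ) * (p - 1) / 2 ≤ 1)
    (hu : IsGlobalPositiveSolution N p φi φb u) {A T : ℝ} (hA : 0 < A) (hT : 8 ≤ T)
    (h : ParabolicLower N u A T) (L : ℝ) : ∃ T', 8 ≤ T' ∧ ParabolicLower N u L T' := by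
  obtain ⟨c, hc, hG⟩ := exists_kernelG_lower N
  have hv := coreVol_pos N
  have hK : 0 < c * coreVol N * A ^ p := by positivity
  obtain ⟨Z, hZ⟩ := (Real.tendsto_log_atTop.eventually_ge_atTop
    (L / (c * coreVol N * A ^ p))).exists_forall_of_atTop
  refine ⟨max (2 * T) (Z * (2 * T)), by linarith [le_max_left (2 * T) (Z * (2 * T))],
    fun t ht x hx1 hx2 hx3 => ?_⟩
  have hT0 : 0 < T := by linarith
  have htT : 2 * T ≤ t := (le_max_left _ _).trans ht
  have ht0 : 0 < t := by linarith
  have hlog : L ≤ c * coreVol N * A ^ p * Real.log (t / 2 / T) := by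
    rw [← div_le_iff₀' hK]
    refine hZ _ ?_
    rw [div_div, le_div_iff₀ (by positivity)]
    exact (le_max_right _ _).trans ht
  refine (mul_le_mul_of_nonneg_right hlog (by positivity)).trans ?_
  have hux := (hu.2 x hx2 t ht0).le
  rw [← ENNReal.ofReal_le_ofReal_iff hux]
  refine le_trans ?_ (hu.1.duhamel_le hp (x := x) hx2 (a := T) (b := t / 2) ht0 hT0.le
    (by linarith) (fun s => core N √s) (fun s => A * s ^ (-(N : ℝ) / 2))
    (fun s hs => core_subset_Omega (Real.sqrt_pos.2 (hT0.trans hs.1)))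
    (fun s _ => measurableSet_core N _)
    (fun s hs => by have := hT0.trans hs.1; positivity)
    (fun s hs y hy => by
      have hy' := mem_core.1 hy
      have := Real.sqrt_nonneg s
      exact h s hs.1.le y (by linarith) (by linarith) hy'.2.2))
  have hlow : ∀ s ∈ Ioo T (t / 2), ENNReal.ofReal (c * coreVol N * A ^ p * t ^ (-(N : ℝ) / 2) *
      s⁻¹) ≤ (∫⁻ y in core N √s, ENNReal.ofReal (kernelG N x y (t - s))) *
        ENNReal.ofReal ((A * s ^ (-(N : ℝ) / 2)) ^ p) := by
    intro s hs
    have h1 := hs.1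
    have h2 := hs.2
    have hs0 : 0 < s := by linarith
    have hsq : 0 < √s := Real.sqrt_pos.2 hs0
    have hst : √s ≤ √t := Real.sqrt_le_sqrt (by linarith)
    have hk := const_mul_volume_le (measurableSet_core N √s) (g := fun y => kernelG N x y (t - s))
      (c := c * t ^ (-(N : ℝ) / 2)) fun y hy => by
        have hy' := mem_core.1 hy
        refine hG x hx2 y (Omega_subset N (core_subset_Omega hsq hy)) t (t - s) (by linarith)
          (by linarith) (by linarith) ?_ ?_
        · linarith [norm_sub_le x.1 y.1]
        · linarith
    refine le_trans ?_ (mul_le_mul_left hk _)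
    rw [volume_core hN hsq, ← ENNReal.ofReal_mul (by positivity),
      ← ENNReal.ofReal_mul (by positivity)]
    refine ENNReal.ofReal_le_ofReal ?_
    have e1 : √s ^ N * (A * s ^ (-(N : ℝ) / 2)) ^ p = A ^ p * s ^ (-((N : ℝ) * (p - 1) / 2)) := by
      rw [Real.mul_rpow hA.le (by positivity), Real.sqrt_eq_rpow, ← Real.rpow_natCast,
        ← Real.rpow_mul hs0.le, ← Real.rpow_mul hs0.le, mul_left_comm, ← Real.rpow_add hs0]
      congr 2
      ring
    have e2 : s⁻¹ ≤ s ^ (-((N : ℝ) * (p - 1) / 2)) := by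
      rw [← Real.rpow_neg_one]
      exact Real.rpow_le_rpow_of_exponent_le (by linarith) (by linarith)
    calc _ ≤ c * coreVol N * A ^ p * t ^ (-(N : ℝ) / 2) * s ^ (-((N : ℝ) * (p - 1) / 2)) := by
          gcongr
      _ = _ := by
          linear_combination (-(c * coreVol N * t ^ (-(N : ℝ) / 2))) * e1
  refine le_trans (le_of_eq ?_) (setLIntegral_mono' measurableSet_Ioo hlow)
  have hle : T ≤ t / 2 := by linarith
  have hcont : ContinuousOn (fun s : ℝ => c * coreVol N * A ^ p * t ^ (-(N : ℝ) / 2) * s⁻¹)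
      (Icc T (t / 2)) := continuousOn_const.mul
    (continuousOn_inv₀.mono fun s hs => (hT0.trans_le hs.1).ne')
  have hint := (hcont.integrableOn_Icc (μ := volume)).mono_set Ioo_subset_Icc_self
  rw [← ofReal_integral_eq_lintegral_ofReal hint, ← integral_Ioc_eq_integral_Ioo,
    ← intervalIntegral.integral_of_le hle, intervalIntegral.integral_const_mul,
    integral_inv_of_pos hT0 (by linarith)]
  · congr 1
    ring
  · refine (ae_restrict_iff' measurableSet_Ioo).2 (Eventually.of_forall fun s hs => ?_)
    have : 0 < s := hT0.trans hs.1
    positivity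

/-- Blow-up: on `core N √t` a solution starting from a large multiple of the critical size becomes
infinite before time `2t`. The bound `M q ^ k` holds from time `t (2 - 2⁻ᵏ)` on. -/
theorem not_forall_core_lower {N : ℕ} {p : ℝ} {φi : Pt N → ℝ} {φb : Bd N → ℝ}
    {u : Pt N → ℝ → ℝ} (hp : 1 < p) (hu : IsSolution N p φi φb ⊤ u) {c : ℝ} (hc : 0 < c)
    (hcore : ∀ R s : ℝ, 0 < R → 0 < s → s ≤ R ^ 2 → ∀ x ∈ core N R,
      ENNReal.ofReal c ≤ ∫⁻ y in core N R, ENNReal.ofReal (kernelG N x y s))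
    {t M : ℝ} (ht : 0 < t) (hM : 0 < M)
    (hMt : 2 * (2 : ℝ) ^ (1 / (p - 1)) ≤ c * t * M ^ (p - 1)) :
    ¬ ∀ s ∈ Icc t (2 * t), ∀ x ∈ core N √t, M ≤ u x s := by
  intro h
  set q : ℝ := (2 : ℝ) ^ (1 / (p - 1)) with hq
  have hp1 : 0 < p - 1 := by linarith
  have hq1 : 1 < q := Real.one_lt_rpow (by norm_num) (by positivity)
  have hqp : q ^ (p - 1) = 2 := by
    rw [hq, ← Real.rpow_mul two_pos.le, one_div_mul_cancel hp1.ne', Real.rpow_one]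
  have hR : 0 < √t := Real.sqrt_pos.2 ht
  have hRR : √t ^ 2 = t := Real.sq_sqrt ht.le
  have hsub : core N √t ⊆ OmegaBar N := (core_subset_Omega hR).trans (Omega_subset N)
  have key : ∀ k : ℕ, ∀ s ∈ Icc (t * (2 - (1 / 2) ^ k)) (2 * t), ∀ x ∈ core N √t,
      M * q ^ k ≤ u x s := by
    intro k
    induction k with
    | zero =>
      intro s hs x hx
      have h1 : t ≤ s := by have := hs.1; norm_num at this; exact this
      simpa using h s ⟨h1, hs.2⟩ x hx
    | succ k ih =>
      intro s hs x hx
      have hk0 : (0 : ℝ) < (1 / 2) ^ k := by positivity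
      have hk1 : ((1 : ℝ) / 2) ^ k ≤ 1 := pow_le_one₀ (by norm_num) (by norm_num)
      set e : ℝ := (1 / 2) ^ k with he
      have hs1 : t * (2 - e / 2) ≤ s := by
        have := hs.1
        rw [pow_succ] at this
        linarith
      have ha : 0 ≤ t * (2 - e) := mul_nonneg ht.le (by linarith)
      have hta : t ≤ t * (2 - e) := by nlinarith
      have has : t * (2 - e) ≤ s := by nlinarith
      have hs0 : 0 < s := by linarith
      have hd := hu.duhamel_le (by linarith : 0 ≤ p) (hsub hx) (a := t * (2 - e)) (b := s) hs0 ha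
        le_rfl (fun _ => core N √t) (fun _ => M * q ^ k) (fun _ _ => core_subset_Omega hR)
        (fun _ _ => measurableSet_core N _) (fun _ _ => by positivity)
        (fun r hr y hy => ih r ⟨hr.1.le, hr.2.le.trans hs.2⟩ y hy)
      have hux := hu.nonneg x (hsub hx) s (mem_times_top.2 hs0)
      rw [← ENNReal.ofReal_le_ofReal_iff hux]
      refine le_trans ?_ hd
      refine le_trans ?_ (setLIntegral_mono' measurableSet_Ioo fun r hr =>
        mul_le_mul_left (hcore √t (s - r) hR (sub_pos.2 hr.2)
          (by rw [hRR]; linarith [hr.1, hs.2]) x hx) _)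
      rw [setLIntegral_const, Real.volume_Ioo, ← ENNReal.ofReal_mul hc.le,
        ← ENNReal.ofReal_mul (by positivity)]
      refine ENNReal.ofReal_le_ofReal ?_
      have e1 : (M * q ^ k) ^ p = M * M ^ (p - 1) * (q ^ k * 2 ^ k) := by
        have hsplit : ∀ z : ℝ, 0 < z → z ^ p = z * z ^ (p - 1) := fun z hz => by
          nth_rewrite 2 [← Real.rpow_one z]
          rw [← Real.rpow_add hz]
          congr 1
          ring
        rw [Real.mul_rpow hM.le (by positivity), hsplit M hM, hsplit (q ^ k) (by positivity),
          ← Real.rpow_pow_comm (by positivity), hqp]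
      have e2 : (2 : ℝ) ^ k * e = 1 := by
        rw [he, ← mul_pow]
        norm_num
      have hgap : t * e / 2 ≤ s - t * (2 - e) := by linarith
      calc M * q ^ (k + 1) = M * q ^ k * (2 * q) / 2 := by ring
        _ ≤ M * q ^ k * (c * t * M ^ (p - 1)) / 2 := by gcongr
        _ = c * (M * M ^ (p - 1) * (q ^ k * 2 ^ k)) * (t * e / 2) := by
            linear_combination (-(M * q ^ k * (c * t * M ^ (p - 1)) / 2)) * e2
        _ ≤ _ := by rw [e1]; gcongr
  have hx0 : ((0, √t) : Pt N) ∈ core N √t := mem_core.2 ⟨by simp, le_rfl, by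
    simp only; linarith⟩
  obtain ⟨k, hk⟩ := pow_unbounded_of_one_lt (u (0, √t) (2 * t) / M) hq1
  rw [div_lt_iff₀' hM] at hk
  exact absurd (key k (2 * t) ⟨by
    have : (0 : ℝ) < (1 / 2) ^ k := by positivity
    nlinarith, le_rfl⟩ _ hx0) (not_le.2 hk)

theorem not_exists_global_of_le_pF {N : ℕ} (hN : 1 ≤ N) {p : ℝ} (hp : 1 < p) (hpF : p ≤ pF N)
    (φi : Pt N → ℝ) (φb : Bd N → ℝ) :
    ¬ ∃ u : Pt N → ℝ → ℝ, IsGlobalPositiveSolution N p φi φb u := by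
  rintro ⟨u, hu⟩
  have hN0 : (0 : ℝ) < N := by exact_mod_cast hN
  have hp1 : 0 < p - 1 := by linarith
  have hcrit : (N : ℝ) * (p - 1) / 2 ≤ 1 := by
    have h1 : p - 1 ≤ 2 / N := by unfold pF at hpF; linarith
    rw [le_div_iff₀ hN0] at h1
    linarith
  obtain ⟨A, hA, hlow⟩ := exists_parabolicLower (by linarith) hu
  obtain ⟨c, hc, hcore⟩ := exists_lintegral_core_lower hN
  set q : ℝ := (2 : ℝ) ^ (1 / (p - 1)) with hq
  have hq0 : 0 < q := by positivity
  set L : ℝ := (4 * q / c) ^ (1 / (p - 1)) with hL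
  have hL0 : 0 < L := by positivity
  have hLp : L ^ (p - 1) = 4 * q / c := by
    rw [hL, ← Real.rpow_mul (by positivity), one_div_mul_cancel hp1.ne', Real.rpow_one]
  obtain ⟨t, ht8, hbig⟩ := hlow.improve hN (by linarith) hcrit hu hA le_rfl L
  have ht : 0 < t := by linarith
  refine not_forall_core_lower hp hu.1 hc hcore ht (M := L * (2 * t) ^ (-(N : ℝ) / 2))
    (by positivity) ?_ fun s hs x hx => ?_
  · have h1 : (2 * t)⁻¹ ≤ ((2 * t) ^ (-(N : ℝ) / 2)) ^ (p - 1) := by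
      rw [← Real.rpow_mul (by positivity), ← Real.rpow_neg_one]
      exact Real.rpow_le_rpow_of_exponent_le (by linarith) (by linarith)
    rw [Real.mul_rpow hL0.le (by positivity), hLp]
    calc 2 * q = c * t * (4 * q / c * (2 * t)⁻¹) := by field_simp; norm_num
      _ ≤ _ := by gcongr
  · have hs1 := hs.1
    have hs2 := hs.2
    have hx' := mem_core.1 hx
    have hst : √t ≤ √s := Real.sqrt_le_sqrt hs1
    have hR := Real.sqrt_nonneg t
    refine le_trans ?_ (hbig s hs1 x (by linarith) (by linarith) (by linarith))
    refine mul_le_mul_of_nonneg_left ?_ hL0.le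
    exact Real.rpow_le_rpow_of_nonpos (by linarith) hs2 (by linarith)

/-! ### The linear semigroup on `[0, ∞]`-valued data -/

/-- The operator `opG` for data `(a, b)` with values in `[0, ∞]`. -/
def pot (N : ℕ) (t : ℝ) (a : Pt N → ℝ≥0∞) (b : Bd N → ℝ≥0∞) (x : Pt N) : ℝ≥0∞ :=
  (∫⁻ y in Omega N, ENNReal.ofReal (kernelG N x y t) * a y) +
    ∫⁻ y : Bd N, ENNReal.ofReal (kernelG N x (bdPt y) t) * b y

theorem opG_eq_pot {N : ℕ} {t : ℝ} (ht : 0 < t) {φi : Pt N → ℝ} {φb : Bd N → ℝ} {x : Pt N}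
    (hx : x ∈ OmegaBar N) : opG N t φi φb x =
      pot N t (fun y => ENNReal.ofReal (φi y)) (fun y => ENNReal.ofReal (φb y)) x := by
  unfold opG pot
  congr 1
  · exact setLIntegral_congr_fun (measurableSet_Omega N) fun y hy =>
      ENNReal.ofReal_mul (kernelG_nonneg hx (Omega_subset N hy) ht)
  · exact lintegral_congr fun y => ENNReal.ofReal_mul (kernelG_nonneg hx (bdPt_mem y) ht)

theorem pot_congr {N : ℕ} {t : ℝ} {a a' : Pt N → ℝ≥0∞} {b b' : Bd N → ℝ≥0∞} (x : Pt N)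
    (ha : a =ᵐ[volume.restrict (Omega N)] a') (hb : b =ᵐ[volume] b') :
    pot N t a b x = pot N t a' b' x := by
  unfold pot
  congr 1
  · exact lintegral_congr_ae (ha.mono fun y hy => by simp only [hy])
  · exact lintegral_congr_ae (hb.mono fun y hy => by simp only [hy])

theorem pot_mono {N : ℕ} {t : ℝ} {a a' : Pt N → ℝ≥0∞} {b b' : Bd N → ℝ≥0∞} (x : Pt N)
    (ha : a ≤ a') (hb : b ≤ b') : pot N t a b x ≤ pot N t a' b' x := by
  unfold pot
  gcongr <;> apply_assumption

theorem measurable_pot {N : ℕ} {X : Type*} [MeasurableSpace X] {f : X → Pt N} {g : X → ℝ}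
    {a : X → Pt N → ℝ≥0∞} {b : X → Bd N → ℝ≥0∞} (hf : Measurable f) (hg : Measurable g)
    (ha : Measurable fun q : X × Pt N => a q.1 q.2)
    (hb : Measurable fun q : X × Bd N => b q.1 q.2) :
    Measurable fun q => pot N (g q) (a q) (b q) (f q) := by
  unfold pot
  refine Measurable.add ?_ ?_
  · refine Measurable.lintegral_prod_right' (f := fun q : X × Pt N =>
      ENNReal.ofReal (kernelG N (f q.1) q.2 (g q.1)) * a q.1 q.2) ?_
    exact (((measurable_kernelG N).comp (show Measurable fun q : X × Pt N =>
      (f q.1, q.2, g q.1) by fun_prop)).ennreal_ofReal).mul ha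
  · refine Measurable.lintegral_prod_right' (f := fun q : X × Bd N =>
      ENNReal.ofReal (kernelG N (f q.1) (bdPt q.2) (g q.1)) * b q.1 q.2) ?_
    exact (((measurable_kernelG N).comp (show Measurable fun q : X × Bd N =>
      (f q.1, bdPt q.2, g q.1) by unfold bdPt; fun_prop)).ennreal_ofReal).mul hb

theorem measurable_ofReal_kernelG_right {N : ℕ} (x : Pt N) (t : ℝ) :
    Measurable fun y => ENNReal.ofReal (kernelG N x y t) :=
  ((measurable_kernelG N).comp (show Measurable fun y : Pt N => (x, y, t) by
    fun_prop)).ennreal_ofReal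

theorem measurable_ofReal_kernelG_bdPt {N : ℕ} (x : Pt N) (t : ℝ) :
    Measurable fun y => ENNReal.ofReal (kernelG N x (bdPt y) t) :=
  (measurable_ofReal_kernelG_right x t).comp (by unfold bdPt; fun_prop)

theorem pot_le_of_ae_le {N : ℕ} (hN : 1 ≤ N) {t : ℝ} (ht : 0 < t) {a : Pt N → ℝ≥0∞}
    {b : Bd N → ℝ≥0∞} {α : ℝ≥0∞} (ha : ∀ᵐ y ∂volume.restrict (Omega N), a y ≤ α)
    (hb : ∀ᵐ y, b y ≤ α) {x : Pt N} (hx : x ∈ OmegaBar N) : pot N t a b x ≤ 3 * α := by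
  unfold pot
  calc _ ≤ (∫⁻ y in Omega N, ENNReal.ofReal (kernelG N x y t) * α) +
        ∫⁻ y : Bd N, ENNReal.ofReal (kernelG N x (bdPt y) t) * α := by
        refine add_le_add (lintegral_mono_ae (ha.mono fun y hy => ?_))
          (lintegral_mono_ae (hb.mono fun y hy => ?_)) <;> gcongr
    _ = ((∫⁻ y in Omega N, ENNReal.ofReal (kernelG N x y t)) +
        ∫⁻ y : Bd N, ENNReal.ofReal (kernelG N x (bdPt y) t)) * α := by
        rw [lintegral_mul_const _ (measurable_ofReal_kernelG_right x t),
          lintegral_mul_const _ (measurable_ofReal_kernelG_bdPt x t), add_mul]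
    _ ≤ _ := by gcongr; exact lintegral_kernelG_le hN hx ht

theorem pot_le_mass {N : ℕ} {t : ℝ} (ht : 0 < t) {a : Pt N → ℝ≥0∞} {b : Bd N → ℝ≥0∞}
    {x : Pt N} (hx : x ∈ OmegaBar N) : pot N t a b x ≤
      ENNReal.ofReal (kernelConst N * (t ^ (-(N : ℝ) / 2) + t ^ (-(N : ℝ)))) *
        ((∫⁻ y in Omega N, a y) + ∫⁻ y, b y) := by
  unfold pot
  rw [mul_add, ← lintegral_const_mul' _ _ ENNReal.ofReal_ne_top,
    ← lintegral_const_mul' _ _ ENNReal.ofReal_ne_top]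
  refine add_le_add (setLIntegral_mono' (measurableSet_Omega N) fun y hy => ?_)
    (lintegral_mono fun y => ?_)
  · gcongr
    exact kernelG_le hx (Omega_subset N hy) ht
  · gcongr
    exact kernelG_le hx (bdPt_mem y) ht

/-- A uniform constant in the decay estimate `pot_le_decay`. -/
def decayConst (N : ℕ) : ℝ := 2 ^ ((N : ℝ) / 2) * (3 + 2 * kernelConst N)

theorem three_le_decayConst (N : ℕ) : 3 ≤ decayConst N := by
  have h1 : (1 : ℝ) ≤ 2 ^ ((N : ℝ) / 2) := Real.one_le_rpow (by norm_num) (by positivity)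
  have h2 := kernelConst_pos N
  unfold decayConst
  nlinarith

theorem rpow_neg_half_le {N : ℕ} {r t : ℝ} (ht : 0 < t) (hrt : t ≤ 2 * r) :
    r ^ (-(N : ℝ) / 2) ≤ 2 ^ ((N : ℝ) / 2) * t ^ (-(N : ℝ) / 2) := by
  have hN : (0 : ℝ) ≤ N := N.cast_nonneg
  have hr : 0 < r := by linarith
  calc r ^ (-(N : ℝ) / 2) ≤ (t / 2) ^ (-(N : ℝ) / 2) :=
        Real.rpow_le_rpow_of_nonpos (by positivity) (by linarith) (by linarith)
    _ = _ := by
        rw [Real.div_rpow ht.le two_pos.le, neg_div, Real.rpow_neg two_pos.le]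
        field_simp

theorem pot_le_decay {N : ℕ} (hN : 1 ≤ N) {t : ℝ} (ht : 0 < t) {a : Pt N → ℝ≥0∞}
    {b : Bd N → ℝ≥0∞} {α : ℝ≥0∞} (ha : ∀ᵐ y ∂volume.restrict (Omega N), a y ≤ α)
    (hb : ∀ᵐ y, b y ≤ α) (hab : (∫⁻ y in Omega N, a y) + ∫⁻ y, b y ≤ α)
    {x : Pt N} (hx : x ∈ OmegaBar N) :
    pot N t a b x ≤ ENNReal.ofReal (decayConst N * (1 + t) ^ (-(N : ℝ) / 2)) * α := by
  have hK := kernelConst_pos N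
  have hN0 : (0 : ℝ) ≤ N := N.cast_nonneg
  have h2 : (0 : ℝ) < 2 ^ ((N : ℝ) / 2) := by positivity
  have h3 : (0 : ℝ) < (1 + t) ^ (-(N : ℝ) / 2) := by positivity
  rcases le_total t 1 with h | h
  · refine (pot_le_of_ae_le hN ht ha hb hx).trans ?_
    gcongr
    rw [show (3 : ℝ≥0∞) = ENNReal.ofReal 3 by norm_num]
    refine ENNReal.ofReal_le_ofReal ?_
    have h1 := rpow_neg_half_le (N := N) (r := 1) (by linarith : 0 < 1 + t) (by linarith)
    rw [Real.one_rpow] at h1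
    unfold decayConst
    calc (3 : ℝ) ≤ (3 + 2 * kernelConst N) * 1 := by linarith
      _ ≤ (3 + 2 * kernelConst N) * (2 ^ ((N : ℝ) / 2) * (1 + t) ^ (-(N : ℝ) / 2)) := by gcongr
      _ = _ := by ring
  · refine (pot_le_mass ht hx).trans (mul_le_mul' (ENNReal.ofReal_le_ofReal ?_) hab)
    have h1 := rpow_neg_half_le (N := N) (r := t) (by linarith : 0 < 1 + t) (by linarith)
    have h4 : t ^ (-(N : ℝ)) ≤ t ^ (-(N : ℝ) / 2) :=
      Real.rpow_le_rpow_of_exponent_le h (by linarith)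
    unfold decayConst
    calc _ ≤ kernelConst N * (t ^ (-(N : ℝ) / 2) + t ^ (-(N : ℝ) / 2)) := by gcongr
      _ = 2 * kernelConst N * t ^ (-(N : ℝ) / 2) := by ring
      _ ≤ (3 + 2 * kernelConst N) * (2 ^ ((N : ℝ) / 2) * (1 + t) ^ (-(N : ℝ) / 2)) := by
          gcongr; linarith
      _ = _ := by ring

theorem lintegral_kernelG_left_le {N : ℕ} (hN : 1 ≤ N) {t : ℝ} (ht : 0 < t) {y : Pt N}
    (hy : y ∈ OmegaBar N) : ∫⁻ x in Omega N, ENNReal.ofReal (kernelG N x y t) ≤ 3 := by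
  rw [lintegral_congr fun x => congrArg ENNReal.ofReal (kernelG_comm x y t)]
  exact le_self_add.trans (lintegral_kernelG_le hN hy ht)

/-- An integral operator whose kernel has mass at most `3` in the first variable is bounded by `3`
on `L¹`. -/
theorem lintegral_kernel_mul_le {X Y : Type*} [MeasurableSpace X] [MeasurableSpace Y]
    {μ : Measure X} {ν : Measure Y} [SFinite μ] [SFinite ν] {k : X → Y → ℝ≥0∞} {a : Y → ℝ≥0∞}
    (hk : Measurable (Function.uncurry k)) (ha : Measurable a)
    (hmass : ∀ᵐ y ∂ν, ∫⁻ x, k x y ∂μ ≤ 3) :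
    ∫⁻ x, ∫⁻ y, k x y * a y ∂ν ∂μ ≤ 3 * ∫⁻ y, a y ∂ν := by
  rw [lintegral_lintegral_swap (f := fun x y => k x y * a y)
    (hk.mul (ha.comp measurable_snd)).aemeasurable, ← lintegral_const_mul _ ha]
  refine lintegral_mono_ae (hmass.mono fun y hy => ?_)
  rw [lintegral_mul_const _ hk.of_uncurry_right]
  gcongr

theorem measurable_ofReal_kernelG {N : ℕ} (t : ℝ) : Measurable
    (Function.uncurry fun x y : Pt N => ENNReal.ofReal (kernelG N x y t)) :=
  Measurable.ennreal_ofReal ((measurable_kernelG N).comp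
    (g := fun q : Pt N × Pt N × ℝ => kernelG N q.1 q.2.1 q.2.2)
    (show Measurable fun q : Pt N × Pt N => (q.1, q.2, t) by fun_prop))

theorem measurable_ofReal_kernelG_bd {N : ℕ} (t : ℝ) : Measurable
    (Function.uncurry fun (x : Pt N) (y : Bd N) => ENNReal.ofReal (kernelG N x (bdPt y) t)) :=
  Measurable.ennreal_ofReal ((measurable_kernelG N).comp
    (g := fun q : Pt N × Pt N × ℝ => kernelG N q.1 q.2.1 q.2.2)
    (show Measurable fun q : Pt N × Bd N => (q.1, bdPt q.2, t) by unfold bdPt; fun_prop))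

/-- The semigroup is bounded on `L¹`, by the mass bound and the symmetry of the kernel. -/
theorem lintegral_pot_le {N : ℕ} (hN : 1 ≤ N) {t : ℝ} (ht : 0 < t) {a : Pt N → ℝ≥0∞}
    {b : Bd N → ℝ≥0∞} (ha : Measurable a) (hb : Measurable b) :
    ∫⁻ x in Omega N, pot N t a b x ≤ 3 * ((∫⁻ y in Omega N, a y) + ∫⁻ y, b y) := by
  have hm : Measurable fun x => ∫⁻ y in Omega N, ENNReal.ofReal (kernelG N x y t) * a y :=
    Measurable.lintegral_prod_right' (f := fun q : Pt N × Pt N =>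
      ENNReal.ofReal (kernelG N q.1 q.2 t) * a q.2)
      ((measurable_ofReal_kernelG t).mul (ha.comp measurable_snd))
  have h1 : ∫⁻ x in Omega N, ∫⁻ y in Omega N, ENNReal.ofReal (kernelG N x y t) * a y ≤
      3 * ∫⁻ y in Omega N, a y :=
    lintegral_kernel_mul_le (measurable_ofReal_kernelG t) ha
      ((ae_restrict_iff' (measurableSet_Omega N)).2 (Eventually.of_forall fun y hy =>
        lintegral_kernelG_left_le hN ht (Omega_subset N hy)))
  have h2 : ∫⁻ x in Omega N, ∫⁻ y : Bd N, ENNReal.ofReal (kernelG N x (bdPt y) t) * b y ≤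
      3 * ∫⁻ y, b y :=
    lintegral_kernel_mul_le (measurable_ofReal_kernelG_bd t) hb
      (Eventually.of_forall fun y => lintegral_kernelG_left_le hN ht (bdPt_mem y))
  unfold pot
  rw [lintegral_add_left hm, mul_add]
  exact add_le_add h1 h2

theorem continuousOn_pot {N : ℕ} {a : Pt N → ℝ≥0∞} {b : Bd N → ℝ≥0∞} (ha : Measurable a)
    (hb : Measurable b) (hai : ∫⁻ y in Omega N, a y ≠ ∞) (hbi : ∫⁻ y, b y ≠ ∞) :
    ContinuousOn (fun q : Pt N × ℝ => pot N q.2 a b q.1) (OmegaBar N ×ˢ Ioi 0) := by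
  rintro ⟨x₀, t₀⟩ hq₀
  have ht₀ : 0 < t₀ := hq₀.2
  have hN : (0 : ℝ) ≤ N := N.cast_nonneg
  set c : ℝ≥0∞ := ENNReal.ofReal (kernelConst N * ((t₀ / 2) ^ (-(N : ℝ) / 2) +
    (t₀ / 2) ^ (-(N : ℝ)))) with hc
  have hbound : ∀ᶠ q : Pt N × ℝ in 𝓝[OmegaBar N ×ˢ Ioi 0] (x₀, t₀), ∀ y ∈ OmegaBar N,
      ENNReal.ofReal (kernelG N q.1 y q.2) ≤ c := by
    have h1 : ∀ᶠ q : Pt N × ℝ in 𝓝[OmegaBar N ×ˢ Ioi 0] (x₀, t₀), t₀ / 2 < q.2 :=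
      nhdsWithin_le_nhds (continuousAt_snd.eventually (lt_mem_nhds (by simp; linarith)))
    filter_upwards [h1, self_mem_nhdsWithin] with q hq hqm y hy
    refine ENNReal.ofReal_le_ofReal ((kernelG_le hqm.1 hy hqm.2).trans ?_)
    refine mul_le_mul_of_nonneg_left (add_le_add ?_ ?_) (kernelConst_pos N).le <;>
      exact Real.rpow_le_rpow_of_nonpos (by linarith) hq.le (by linarith)
  have hlim : ∀ y ∈ OmegaBar N, ∀ z : ℝ≥0∞, z < ∞ →
      Tendsto (fun q : Pt N × ℝ => ENNReal.ofReal (kernelG N q.1 y q.2) * z)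
        (𝓝[OmegaBar N ×ˢ Ioi 0] (x₀, t₀)) (𝓝 (ENNReal.ofReal (kernelG N x₀ y t₀) * z)) :=
    fun y hy z hz => ENNReal.Tendsto.mul_const
      (ENNReal.tendsto_ofReal (continuousOn_kernelG hy _ hq₀)) (Or.inr hz.ne)
  refine Tendsto.add ?_ ?_
  · refine tendsto_lintegral_filter_of_dominated_convergence (fun y => c * a y)
      (Eventually.of_forall fun q => (measurable_ofReal_kernelG_right q.1 q.2).mul ha) ?_ ?_ ?_
    · filter_upwards [hbound] with q hq
      refine (ae_restrict_iff' (measurableSet_Omega N)).2 (Eventually.of_forall fun y hy => ?_)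
      gcongr
      exact hq y (Omega_subset N hy)
    · rw [lintegral_const_mul _ ha]
      exact ENNReal.mul_ne_top ENNReal.ofReal_ne_top hai
    · filter_upwards [ae_lt_top ha hai, ae_restrict_mem (measurableSet_Omega N)] with y hy hyO
      exact hlim y (Omega_subset N hyO) _ hy
  · refine tendsto_lintegral_filter_of_dominated_convergence (fun y => c * b y)
      (Eventually.of_forall fun q => (measurable_ofReal_kernelG_bdPt q.1 q.2).mul hb) ?_ ?_ ?_
    · filter_upwards [hbound] with q hq
      refine Eventually.of_forall fun y => ?_
      gcongr
      exact hq _ (bdPt_mem y)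
    · rw [lintegral_const_mul _ hb]
      exact ENNReal.mul_ne_top ENNReal.ofReal_ne_top hbi
    · filter_upwards [ae_lt_top hb hbi] with y hy
      exact hlim _ (bdPt_mem y) _ hy

theorem pot_ne_zero {N : ℕ} {t : ℝ} (ht : 0 < t) {a : Pt N → ℝ≥0∞} {b : Bd N → ℝ≥0∞}
    (ha : Measurable a) (hb : Measurable b) {x : Pt N} (hx : x ∈ OmegaBar N)
    (hab : ¬ (a =ᵐ[volume.restrict (Omega N)] 0 ∧ b =ᵐ[volume] 0)) : pot N t a b x ≠ 0 := by
  refine fun h => hab ?_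
  obtain ⟨h1, h2⟩ := add_eq_zero.1 h
  replace h1 := (lintegral_eq_zero_iff ((measurable_ofReal_kernelG_right x t).mul ha)).1 h1
  replace h2 := (lintegral_eq_zero_iff ((measurable_ofReal_kernelG_bdPt x t).mul hb)).1 h2
  constructor
  · filter_upwards [h1, ae_restrict_mem (measurableSet_Omega N)] with y hy hyO
    exact (mul_eq_zero.1 hy).resolve_left
      (ENNReal.ofReal_pos.2 (kernelG_pos hx (Omega_subset N hyO) ht)).ne'
  · filter_upwards [h2] with y hy
    exact (mul_eq_zero.1 hy).resolve_left
      (ENNReal.ofReal_pos.2 (kernelG_pos hx (bdPt_mem y) ht)).ne'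

/-! ### Global existence above the critical exponent -/

/-- The Duhamel integral `∫₀ᵗ [G(t-s)(v(s)^p, 0)](x) ds` of a `[0, ∞]`-valued function. -/
def duhamel (N : ℕ) (p : ℝ) (v : Pt N → ℝ → ℝ≥0∞) (x : Pt N) (t : ℝ) : ℝ≥0∞ :=
  ∫⁻ s in Ioo 0 t, pot N (t - s) (fun y => v y s ^ p) 0 x

/-- The Picard iteration for the integral equation, starting from `0`. -/
def picard (N : ℕ) (p : ℝ) (a : Pt N → ℝ≥0∞) (b : Bd N → ℝ≥0∞) : ℕ → Pt N → ℝ → ℝ≥0∞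
  | 0 => fun _ _ => 0
  | n + 1 => fun x t => pot N t a b x + duhamel N p (picard N p a b n) x t

theorem measurable_source {N : ℕ} {p : ℝ} {v : Pt N → ℝ → ℝ≥0∞}
    (hv : Measurable (Function.uncurry v)) :
    Measurable fun q : (Pt N × ℝ) × ℝ => pot N (q.1.2 - q.2) (fun y => v y q.2 ^ p) 0 q.1.1 :=
  measurable_pot (X := (Pt N × ℝ) × ℝ) (f := fun q => q.1.1) (g := fun q => q.1.2 - q.2)
    (a := fun q y => v y q.2 ^ p) (b := fun _ => 0) (by fun_prop) (by fun_prop)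
    ((hv.comp (show Measurable fun r : ((Pt N × ℝ) × ℝ) × Pt N => (r.2, r.1.2) by
      fun_prop)).pow_const p) measurable_const

theorem measurable_source_time {N : ℕ} {p : ℝ} {v : Pt N → ℝ → ℝ≥0∞}
    (hv : Measurable (Function.uncurry v)) (x : Pt N) (t : ℝ) :
    Measurable fun s : ℝ => pot N (t - s) (fun y => v y s ^ p) 0 x :=
  measurable_pot (X := ℝ) (f := fun _ => x) (g := fun s => t - s)
    (a := fun s y => v y s ^ p) (b := fun _ => 0) measurable_const (by fun_prop)
    ((hv.comp measurable_swap).pow_const p) measurable_const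

theorem duhamel_eq_indicator {N : ℕ} {p : ℝ} (v : Pt N → ℝ → ℝ≥0∞) (q : Pt N × ℝ) :
    duhamel N p v q.1 q.2 = ∫⁻ s, {r : (Pt N × ℝ) × ℝ | 0 < r.2 ∧ r.2 < r.1.2}.indicator
      (fun r => pot N (r.1.2 - r.2) (fun y => v y r.2 ^ p) 0 r.1.1) (q, s) := by
  unfold duhamel
  rw [← lintegral_indicator measurableSet_Ioo]
  rfl

theorem measurable_indicator_source {N : ℕ} {p : ℝ} {v : Pt N → ℝ → ℝ≥0∞}
    (hv : Measurable (Function.uncurry v)) :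
    Measurable ({r : (Pt N × ℝ) × ℝ | 0 < r.2 ∧ r.2 < r.1.2}.indicator
      (fun r => pot N (r.1.2 - r.2) (fun y => v y r.2 ^ p) 0 r.1.1)) :=
  (measurable_source hv).indicator ((measurableSet_lt measurable_const measurable_snd).inter
    (measurableSet_lt measurable_snd (by fun_prop)))

theorem measurable_duhamel {N : ℕ} {p : ℝ} {v : Pt N → ℝ → ℝ≥0∞}
    (hv : Measurable (Function.uncurry v)) :
    Measurable fun q : Pt N × ℝ => duhamel N p v q.1 q.2 := by
  simp only [duhamel_eq_indicator]
  exact (measurable_indicator_source hv).lintegral_prod_right'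

theorem measurable_picard {N : ℕ} {p : ℝ} {a : Pt N → ℝ≥0∞} {b : Bd N → ℝ≥0∞}
    (ha : Measurable a) (hb : Measurable b) (n : ℕ) :
    Measurable (Function.uncurry (picard N p a b n)) := by
  induction n with
  | zero => exact measurable_const
  | succ n ih =>
    refine Measurable.add ?_ (measurable_duhamel ih)
    exact measurable_pot (X := Pt N × ℝ) (f := fun q => q.1) (g := fun q => q.2)
      (a := fun _ => a) (b := fun _ => b) measurable_fst measurable_snd
      (ha.comp measurable_snd) (hb.comp measurable_snd)

theorem duhamel_mono {N : ℕ} {p : ℝ} (hp : 0 ≤ p) {v w : Pt N → ℝ → ℝ≥0∞} (h : v ≤ w)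
    (x : Pt N) (t : ℝ) : duhamel N p v x t ≤ duhamel N p w x t :=
  lintegral_mono fun s => pot_mono x (fun y => ENNReal.rpow_le_rpow (h y s) hp) le_rfl

theorem picard_mono {N : ℕ} {p : ℝ} (hp : 0 ≤ p) (a : Pt N → ℝ≥0∞) (b : Bd N → ℝ≥0∞) :
    Monotone (picard N p a b) := by
  refine monotone_nat_of_le_succ fun n => ?_
  induction n with
  | zero => exact fun x t => zero_le
  | succ n ih => exact fun x t => add_le_add le_rfl (duhamel_mono hp ih x t)

theorem duhamel_iSup {N : ℕ} {p : ℝ} (hp : 0 < p) {v : ℕ → Pt N → ℝ → ℝ≥0∞}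
    (hv : ∀ n, Measurable (Function.uncurry (v n))) (hmono : Monotone v) (x : Pt N) (t : ℝ) :
    duhamel N p (fun y s => ⨆ n, v n y s) x t = ⨆ n, duhamel N p (v n) x t := by
  have hpow : ∀ y s, (⨆ n, v n y s) ^ p = ⨆ n, v n y s ^ p := fun y s =>
    (ENNReal.orderIsoRpow p hp).map_iSup _
  have hpot : ∀ s, pot N (t - s) (fun y => (⨆ n, v n y s) ^ p) 0 x =
      ⨆ n, pot N (t - s) (fun y => v n y s ^ p) 0 x := fun s => by
    have h1 : ∫⁻ y in Omega N, ⨆ n, ENNReal.ofReal (kernelG N x y (t - s)) * v n y s ^ p =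
        ⨆ n, ∫⁻ y in Omega N, ENNReal.ofReal (kernelG N x y (t - s)) * v n y s ^ p :=
      lintegral_iSup (fun n => (measurable_ofReal_kernelG_right x (t - s)).mul
        ((hv n).of_uncurry_right.pow_const p))
        fun m n hmn y => mul_le_mul_right (ENNReal.rpow_le_rpow (hmono hmn y s) hp.le) _
    simpa only [pot, hpow, Pi.zero_apply, mul_zero, lintegral_zero, add_zero,
      ENNReal.mul_iSup] using h1
  have h2 : ∫⁻ s in Ioo 0 t, ⨆ n, pot N (t - s) (fun y => v n y s ^ p) 0 x =
      ⨆ n, ∫⁻ s in Ioo 0 t, pot N (t - s) (fun y => v n y s ^ p) 0 x :=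
    lintegral_iSup (fun n => measurable_source_time (hv n) x t) fun m n hmn s =>
      pot_mono x (fun y => ENNReal.rpow_le_rpow (hmono hmn y s) hp.le) le_rfl
  unfold duhamel
  rw [← h2]
  exact lintegral_congr hpot

/-- The decay and mass bounds that the Picard iteration preserves. -/
structure DecayBound (N : ℕ) (M : ℝ) (v : Pt N → ℝ → ℝ≥0∞) : Prop where
  sup_le : ∀ x ∈ OmegaBar N, ∀ t, 0 < t → v x t ≤ ENNReal.ofReal (M * (1 + t) ^ (-(N : ℝ) / 2))
  mass_le : ∀ t, 0 < t → ∫⁻ x in Omega N, v x t ≤ ENNReal.ofReal M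

section Source

variable {N : ℕ} {p M : ℝ} {v : Pt N → ℝ → ℝ≥0∞}

theorem DecayBound.pow_le (h : DecayBound N M v) (hM : 0 ≤ M) (hp : 0 ≤ p) {x : Pt N}
    (hx : x ∈ OmegaBar N) {s : ℝ} (hs : 0 < s) :
    v x s ^ p ≤ ENNReal.ofReal (M ^ p * (1 + s) ^ (-((N : ℝ) * p / 2))) := by
  refine (ENNReal.rpow_le_rpow (h.sup_le x hx s hs) hp).trans (le_of_eq ?_)
  rw [ENNReal.ofReal_rpow_of_nonneg (by positivity) hp, Real.mul_rpow hM (by positivity),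
    ← Real.rpow_mul (by positivity)]
  congr 3
  ring

/-- The weaker rate that also holds for the `L¹` norm, see `DecayBound.lintegral_pow_le`. -/
theorem DecayBound.pow_le' (h : DecayBound N M v) (hM : 0 ≤ M) (hp : 0 ≤ p) {x : Pt N}
    (hx : x ∈ OmegaBar N) {s : ℝ} (hs : 0 < s) :
    v x s ^ p ≤ ENNReal.ofReal (M ^ p * (1 + s) ^ (-((N : ℝ) * (p - 1) / 2))) := by
  refine (h.pow_le hM hp hx hs).trans (ENNReal.ofReal_le_ofReal ?_)
  gcongr
  · linarith
  · linarith

theorem DecayBound.lintegral_pow_le (h : DecayBound N M v) (hM : 0 < M) (hp : 1 ≤ p) {s : ℝ}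
    (hs : 0 < s) : ∫⁻ x in Omega N, v x s ^ p ≤
      ENNReal.ofReal (M ^ p * (1 + s) ^ (-((N : ℝ) * (p - 1) / 2))) := by
  have hp1 : 0 ≤ p - 1 := by linarith
  calc ∫⁻ x in Omega N, v x s ^ p ≤ ∫⁻ x in Omega N,
        ENNReal.ofReal (M ^ (p - 1) * (1 + s) ^ (-((N : ℝ) * (p - 1) / 2))) * v x s := by
        refine setLIntegral_mono' (measurableSet_Omega N) fun x hx => ?_
        have h1 := h.pow_le (p := p - 1) hM.le hp1 (Omega_subset N hx) hs
        calc v x s ^ p = v x s ^ (p - 1) * v x s := by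
              nth_rewrite 3 [← ENNReal.rpow_one (v x s)]
              rw [← ENNReal.rpow_add_of_nonneg _ _ hp1 zero_le_one, sub_add_cancel]
          _ ≤ _ := by gcongr
    _ ≤ ENNReal.ofReal (M ^ (p - 1) * (1 + s) ^ (-((N : ℝ) * (p - 1) / 2))) *
        ENNReal.ofReal M := by
        rw [lintegral_const_mul' _ _ ENNReal.ofReal_ne_top]
        gcongr
        exact h.mass_le s hs
    _ = _ := by
        rw [← ENNReal.ofReal_mul (by positivity)]
        congr 1
        have : M ^ p = M ^ (p - 1) * M := by
          nth_rewrite 3 [← Real.rpow_one M]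
          rw [← Real.rpow_add hM, sub_add_cancel]
        rw [this]
        ring

/-- For `s ≤ t / 2` the semigroup provides the decay in `t`, for `s ≥ t / 2` the source does. -/
theorem DecayBound.pot_source_le (hN : 1 ≤ N) (h : DecayBound N M v) (hM : 0 < M) (hp : 1 ≤ p)
    {x : Pt N} (hx : x ∈ OmegaBar N) {s t : ℝ} (hs : 0 < s) (hst : s < t) :
    pot N (t - s) (fun y => v y s ^ p) 0 x ≤
      ENNReal.ofReal (2 ^ ((N : ℝ) / 2) * decayConst N * M ^ p * (1 + t) ^ (-(N : ℝ) / 2) *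
        (1 + s) ^ (-((N : ℝ) * (p - 1) / 2))) := by
  have hd := three_le_decayConst N
  have ht : 0 < t - s := sub_pos.2 hst
  rcases le_total s (t / 2) with h2 | h2
  · refine (pot_le_decay hN ht
      ((ae_restrict_iff' (measurableSet_Omega N)).2 (Eventually.of_forall fun y hy =>
        h.pow_le' hM.le (by linarith) (Omega_subset N hy) hs))
      (Eventually.of_forall fun _ => zero_le) ?_ hx).trans ?_
    · simpa using h.lintegral_pow_le hM hp hs
    · rw [← ENNReal.ofReal_mul (by positivity)]
      refine ENNReal.ofReal_le_ofReal ?_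
      have h3 := rpow_neg_half_le (N := N) (r := 1 + (t - s)) (t := 1 + t) (by linarith)
        (by linarith)
      calc _ ≤ decayConst N * (2 ^ ((N : ℝ) / 2) * (1 + t) ^ (-(N : ℝ) / 2)) *
            (M ^ p * (1 + s) ^ (-((N : ℝ) * (p - 1) / 2))) := by gcongr
        _ = _ := by ring
  · refine (pot_le_of_ae_le hN ht
      ((ae_restrict_iff' (measurableSet_Omega N)).2 (Eventually.of_forall fun y hy =>
        h.pow_le hM.le (by linarith) (Omega_subset N hy) hs))
      (Eventually.of_forall fun _ => zero_le) hx).trans ?_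
    rw [show (3 : ℝ≥0∞) = ENNReal.ofReal 3 by norm_num, ← ENNReal.ofReal_mul (by norm_num)]
    refine ENNReal.ofReal_le_ofReal ?_
    have h3 := rpow_neg_half_le (N := N) (r := 1 + s) (t := 1 + t) (by linarith) (by linarith)
    have h4 : (1 + s) ^ (-((N : ℝ) * p / 2)) =
        (1 + s) ^ (-(N : ℝ) / 2) * (1 + s) ^ (-((N : ℝ) * (p - 1) / 2)) := by
      rw [← Real.rpow_add (by positivity)]
      congr 1
      ring
    rw [h4]
    calc _ ≤ decayConst N * (M ^ p * ((2 ^ ((N : ℝ) / 2) * (1 + t) ^ (-(N : ℝ) / 2)) *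
          (1 + s) ^ (-((N : ℝ) * (p - 1) / 2)))) := by gcongr
      _ = _ := by ring

end Source

theorem lintegral_time_decay_le {q : ℝ} (hq : 1 < q) (t : ℝ) :
    ∫⁻ s in Ioo 0 t, ENNReal.ofReal ((1 + s) ^ (-q)) ≤
      ENNReal.ofReal (∫ s in Ioi (0 : ℝ), (1 + s) ^ (-q)) := by
  have hi : IntegrableOn (fun s : ℝ => (1 + s) ^ (-q)) (Ioi 0) := by
    have := integrableOn_add_rpow_Ioi_of_lt (a := -q) (c := 0) (m := 1) (by linarith) (by norm_num)
    simpa only [add_comm] using this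
  rw [ofReal_integral_eq_lintegral_ofReal hi ((ae_restrict_iff' measurableSet_Ioi).2
    (Eventually.of_forall fun s (hs : 0 < s) => by positivity))]
  exact lintegral_mono_set Ioo_subset_Ioi_self

theorem DecayBound.picard_step {N : ℕ} (hN : 1 ≤ N) {p M δ J : ℝ} {v : Pt N → ℝ → ℝ≥0∞}
    (hp : 1 ≤ p) (hM : 0 < M) (hδ : 0 ≤ δ) (hv : Measurable (Function.uncurry v))
    (h : DecayBound N M v) {a : Pt N → ℝ≥0∞} {b : Bd N → ℝ≥0∞} (ha : Measurable a)
    (hb : Measurable b) (haδ : ∀ᵐ y ∂volume.restrict (Omega N), a y ≤ ENNReal.ofReal δ)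
    (hbδ : ∀ᵐ y, b y ≤ ENNReal.ofReal δ)
    (habδ : (∫⁻ y in Omega N, a y) + ∫⁻ y, b y ≤ ENNReal.ofReal δ) (hJ0 : 0 ≤ J)
    (hJ : ∀ t, ∫⁻ s in Ioo 0 t, ENNReal.ofReal ((1 + s) ^ (-((N : ℝ) * (p - 1) / 2))) ≤
      ENNReal.ofReal J)
    (hsmall : 2 ^ ((N : ℝ) / 2) * decayConst N * (δ + M ^ p * J) ≤ M) :
    DecayBound N M fun x t => pot N t a b x + duhamel N p v x t := by
  have hd := three_le_decayConst N
  have h2 : (1 : ℝ) ≤ 2 ^ ((N : ℝ) / 2) := Real.one_le_rpow (by norm_num) (by positivity)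
  have hle : decayConst N ≤ 2 ^ ((N : ℝ) / 2) * decayConst N :=
    le_mul_of_one_le_left (by linarith) h2
  have hMp : 0 < M ^ p := by positivity
  constructor
  · intro x hx t ht
    have h1 := pot_le_decay hN ht haδ hbδ habδ hx
    have h3 : duhamel N p v x t ≤ ENNReal.ofReal (2 ^ ((N : ℝ) / 2) * decayConst N * M ^ p *
        (1 + t) ^ (-(N : ℝ) / 2)) * ENNReal.ofReal J := by
      refine le_trans ?_ (mul_le_mul_right (hJ t) _)
      rw [← lintegral_const_mul' _ _ ENNReal.ofReal_ne_top]
      refine setLIntegral_mono' measurableSet_Ioo fun s hs => ?_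
      rw [← ENNReal.ofReal_mul (by positivity)]
      exact h.pot_source_le hN hM hp hx hs.1 hs.2
    refine (add_le_add h1 h3).trans ?_
    rw [← ENNReal.ofReal_mul (by positivity), ← ENNReal.ofReal_mul (by positivity),
      ← ENNReal.ofReal_add (by positivity) (by positivity)]
    refine ENNReal.ofReal_le_ofReal ?_
    calc _ ≤ 2 ^ ((N : ℝ) / 2) * decayConst N * (1 + t) ^ (-(N : ℝ) / 2) * δ +
          2 ^ ((N : ℝ) / 2) * decayConst N * M ^ p * (1 + t) ^ (-(N : ℝ) / 2) * J := by gcongr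
      _ = 2 ^ ((N : ℝ) / 2) * decayConst N * (δ + M ^ p * J) * (1 + t) ^ (-(N : ℝ) / 2) := by ring
      _ ≤ _ := by gcongr
  · intro t ht
    have hmp : Measurable fun x => pot N t a b x :=
      measurable_pot (X := Pt N) (f := fun x => x) (g := fun _ => t) (a := fun _ => a)
        (b := fun _ => b) measurable_id measurable_const (ha.comp measurable_snd)
        (hb.comp measurable_snd)
    rw [lintegral_add_left hmp]
    have h1 := (lintegral_pot_le hN ht ha hb).trans (mul_le_mul_right habδ 3)
    have h3 : ∫⁻ x in Omega N, duhamel N p v x t ≤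
        3 * (ENNReal.ofReal (M ^ p) * ENNReal.ofReal J) := by
      unfold duhamel
      rw [lintegral_lintegral_swap
        (f := fun x s => pot N (t - s) (fun y => v y s ^ p) 0 x) ((measurable_source hv).comp
          (show Measurable fun r : Pt N × ℝ => ((r.1, t), r.2) by fun_prop)).aemeasurable]
      refine le_trans ?_ (mul_le_mul_right (mul_le_mul_right (hJ t) _) _)
      rw [← lintegral_const_mul' _ _ ENNReal.ofReal_ne_top,
        ← lintegral_const_mul' _ _ (by norm_num)]
      refine setLIntegral_mono' measurableSet_Ioo fun s hs => ?_
      have hm : Measurable fun y => v y s ^ p :=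
        (hv.comp (show Measurable fun y : Pt N => (y, s) by fun_prop)).pow_const p
      refine (lintegral_pot_le hN (sub_pos.2 hs.2) hm measurable_const).trans ?_
      rw [← ENNReal.ofReal_mul hMp.le]
      gcongr
      simpa using h.lintegral_pow_le hM hp hs.1
    refine (add_le_add h1 h3).trans ?_
    rw [show (3 : ℝ≥0∞) = ENNReal.ofReal 3 by norm_num, ← ENNReal.ofReal_mul (by norm_num),
      ← ENNReal.ofReal_mul hMp.le, ← ENNReal.ofReal_mul (by norm_num),
      ← ENNReal.ofReal_add (by positivity) (by positivity)]
    refine ENNReal.ofReal_le_ofReal (le_trans ?_ hsmall)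
    have h4 : 0 ≤ δ + M ^ p * J := by positivity
    calc _ = 3 * (δ + M ^ p * J) := by ring
      _ ≤ _ := by gcongr; linarith

theorem continuousOn_duhamel {N : ℕ} (hN : 1 ≤ N) {p M : ℝ} {v : Pt N → ℝ → ℝ≥0∞} (hp : 1 ≤ p)
    (hM : 0 < M) (hv : Measurable (Function.uncurry v)) (h : DecayBound N M v) :
    ContinuousOn (fun q : Pt N × ℝ => duhamel N p v q.1 q.2) (OmegaBar N ×ˢ Ioi 0) := by
  rintro ⟨x₀, t₀⟩ hq₀
  have ht₀ : 0 < t₀ := hq₀.2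
  have hle : ∀ y ∈ OmegaBar N, ∀ s, 0 < s → v y s ^ p ≤ ENNReal.ofReal (M ^ p) :=
    fun y hy s hs => (h.pow_le hM.le (by linarith) hy hs).trans (ENNReal.ofReal_le_ofReal
      (mul_le_of_le_one_right (by positivity) (Real.rpow_le_one_of_one_le_of_nonpos (by linarith)
        (neg_nonpos.2 (div_nonneg (mul_nonneg N.cast_nonneg (by linarith)) two_pos.le)))))
  simp only [duhamel_eq_indicator]
  have hlt : ∀ᶠ q : Pt N × ℝ in 𝓝[OmegaBar N ×ˢ Ioi 0] (x₀, t₀), q.2 < t₀ + 1 :=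
    nhdsWithin_le_nhds (continuousAt_snd.eventually (gt_mem_nhds (by simp)))
  refine tendsto_lintegral_filter_of_dominated_convergence
    ((Ioo 0 (t₀ + 1)).indicator fun _ => 3 * ENNReal.ofReal (M ^ p))
    (Eventually.of_forall fun q => (measurable_indicator_source hv).comp
      (show Measurable fun s : ℝ => (q, s) by fun_prop)) ?_ ?_ ?_
  · filter_upwards [hlt, self_mem_nhdsWithin] with q hq hqm
    refine Eventually.of_forall fun s => ?_
    by_cases hs : 0 < s ∧ s < q.2
    · rw [indicator_of_mem (show (q, s) ∈ {r : (Pt N × ℝ) × ℝ | 0 < r.2 ∧ r.2 < r.1.2} from hs),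
        indicator_of_mem (show s ∈ Ioo 0 (t₀ + 1) from ⟨hs.1, hs.2.trans hq⟩)]
      exact pot_le_of_ae_le hN (sub_pos.2 hs.2)
        ((ae_restrict_iff' (measurableSet_Omega N)).2 (Eventually.of_forall fun y hy =>
          hle y (Omega_subset N hy) s hs.1)) (Eventually.of_forall fun _ => zero_le) hqm.1
    · rw [indicator_of_notMem
        (show (q, s) ∉ {r : (Pt N × ℝ) × ℝ | 0 < r.2 ∧ r.2 < r.1.2} from hs)]
      exact zero_le
  · rw [lintegral_indicator measurableSet_Ioo, setLIntegral_const]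
    exact ENNReal.mul_ne_top (ENNReal.mul_ne_top (by norm_num) ENNReal.ofReal_ne_top) (by simp)
  · filter_upwards [compl_mem_ae_iff.2 (measure_singleton t₀)] with s hs
    have hsnd : Tendsto (fun q : Pt N × ℝ => q.2) (𝓝[OmegaBar N ×ˢ Ioi 0] (x₀, t₀)) (𝓝 t₀) :=
      continuousWithinAt_snd
    rcases le_or_gt s 0 with h0 | h0
    · have hz : ∀ q : Pt N × ℝ, (q, s) ∉ {r : (Pt N × ℝ) × ℝ | 0 < r.2 ∧ r.2 < r.1.2} :=
        fun q hq => absurd hq.1 (not_lt.2 h0)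
      simp only [indicator_of_notMem (hz _)]
      exact tendsto_const_nhds
    rcases lt_or_gt_of_ne (show s ≠ t₀ from hs) with h1 | h1
    · have hev : ∀ᶠ q : Pt N × ℝ in 𝓝[OmegaBar N ×ˢ Ioi 0] (x₀, t₀), s < q.2 :=
        hsnd.eventually (lt_mem_nhds h1)
      have hmap : Tendsto (fun q : Pt N × ℝ => (q.1, q.2 - s))
          (𝓝[OmegaBar N ×ˢ Ioi 0] (x₀, t₀)) (𝓝[OmegaBar N ×ˢ Ioi 0] (x₀, t₀ - s)) := by
        refine tendsto_nhdsWithin_iff.2 ⟨?_, ?_⟩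
        · exact ((by fun_prop : Continuous fun q : Pt N × ℝ => (q.1, q.2 - s)).tendsto
            (x₀, t₀)).mono_left nhdsWithin_le_nhds
        · filter_upwards [hev, self_mem_nhdsWithin] with q hq hqm
          exact ⟨hqm.1, sub_pos.2 hq⟩
      have hcont := continuousOn_pot (N := N) (a := fun y => v y s ^ p) (b := 0)
        (hv.of_uncurry_right.pow_const p) measurable_const
        ((h.lintegral_pow_le hM hp h0).trans_lt ENNReal.ofReal_lt_top).ne (by simp)
        (x₀, t₀ - s) ⟨hq₀.1, sub_pos.2 h1⟩
      rw [indicator_of_mem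
        (show ((x₀, t₀), s) ∈ {r : (Pt N × ℝ) × ℝ | 0 < r.2 ∧ r.2 < r.1.2} from ⟨h0, h1⟩)]
      refine (Tendsto.comp hcont hmap).congr' ?_
      filter_upwards [hev] with q hq
      rw [indicator_of_mem
        (show (q, s) ∈ {r : (Pt N × ℝ) × ℝ | 0 < r.2 ∧ r.2 < r.1.2} from ⟨h0, hq⟩)]
      rfl
    · have hz : ∀ q : Pt N × ℝ, q.2 < s →
          (q, s) ∉ {r : (Pt N × ℝ) × ℝ | 0 < r.2 ∧ r.2 < r.1.2} :=
        fun q hq hr => absurd hr.2 (not_lt.2 hq.le)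
      rw [indicator_of_notMem (hz (x₀, t₀) h1)]
      refine tendsto_const_nhds.congr' ?_
      filter_upwards [hsnd.eventually (gt_mem_nhds h1)] with q hq
      rw [indicator_of_notMem (hz q hq)]

/-- Small data, in terms of `[0, ∞]`-valued data: the limit of the Picard iteration. -/
theorem exists_fixed_point {N : ℕ} (hN : 1 ≤ N) {p : ℝ} (hp : 1 < p) (hpF : pF N < p) :
    ∃ δ M : ℝ, 0 < δ ∧ 0 < M ∧ ∀ (a : Pt N → ℝ≥0∞) (b : Bd N → ℝ≥0∞), Measurable a →
      Measurable b → (∀ᵐ y ∂volume.restrict (Omega N), a y ≤ ENNReal.ofReal δ) →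
      (∀ᵐ y, b y ≤ ENNReal.ofReal δ) →
      (∫⁻ y in Omega N, a y) + ∫⁻ y, b y ≤ ENNReal.ofReal δ →
      ∃ v : Pt N → ℝ → ℝ≥0∞, Measurable (Function.uncurry v) ∧ DecayBound N M v ∧
        ∀ x t, v x t = pot N t a b x + duhamel N p v x t := by
  have hN0 : (0 : ℝ) < N := by exact_mod_cast hN
  have hp1 : 0 < p - 1 := by linarith
  have hq : 1 < (N : ℝ) * (p - 1) / 2 := by
    have h1 : 2 / (N : ℝ) < p - 1 := by unfold pF at hpF; linarith
    rw [div_lt_iff₀ hN0] at h1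
    linarith
  set J : ℝ := ∫ s in Ioi (0 : ℝ), (1 + s) ^ (-((N : ℝ) * (p - 1) / 2)) with hJ
  have hJ0 : 0 ≤ J := setIntegral_nonneg measurableSet_Ioi fun s (hs : 0 < s) => by positivity
  have hd := three_le_decayConst N
  set C : ℝ := 2 ^ ((N : ℝ) / 2) * decayConst N with hC
  have hC0 : 0 < C := by positivity
  -- `M` and `δ` are chosen so that `C M ^ p J ≤ M / 2` and `C δ = M / 2`
  set M : ℝ := (1 / (2 * C * (J + 1))) ^ (1 / (p - 1)) with hM
  have hM0 : 0 < M := by positivity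
  have hMp : M ^ p = M * (1 / (2 * C * (J + 1))) := by
    have h1 : M ^ (p - 1) = 1 / (2 * C * (J + 1)) := by
      rw [hM, ← Real.rpow_mul (by positivity), one_div_mul_cancel hp1.ne', Real.rpow_one]
    rw [← h1]
    nth_rewrite 2 [← Real.rpow_one M]
    rw [← Real.rpow_add hM0]
    congr 1
    ring
  have hsmall : C * (M / (2 * C) + M ^ p * J) ≤ M := by
    rw [hMp]
    have h1 : J / (J + 1) ≤ 1 := (div_le_one (by positivity)).2 (by linarith)
    calc _ = M / 2 + M / 2 * (J / (J + 1)) := by field_simp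
      _ ≤ M / 2 + M / 2 * 1 := by gcongr
      _ = M := by ring
  refine ⟨M / (2 * C), M, by positivity, hM0, fun a b ha hb haδ hbδ hab => ?_⟩
  have hmono := picard_mono (N := N) (p := p) (by linarith) a b
  have hmeas := measurable_picard (p := p) ha hb
  have hbd : ∀ n, DecayBound N M (picard N p a b n) := fun n => by
    induction n with
    | zero => exact ⟨fun _ _ _ _ => zero_le, fun _ _ => by simp [picard]⟩
    | succ n ih =>
      exact ih.picard_step hN hp.le hM0 (by positivity) (hmeas n) ha hb haδ hbδ hab hJ0
        (lintegral_time_decay_le hq) hsmall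
  refine ⟨fun x t => ⨆ n, picard N p a b n x t, Measurable.iSup hmeas, ⟨?_, ?_⟩, ?_⟩
  · exact fun x hx t ht => iSup_le fun n => (hbd n).sup_le x hx t ht
  · intro t ht
    rw [lintegral_iSup (fun n => (hmeas n).of_uncurry_right) fun m n hmn x => hmono hmn x t]
    exact iSup_le fun n => (hbd n).mass_le t ht
  · intro x t
    rw [duhamel_iSup (by linarith) hmeas hmono, ENNReal.add_iSup]
    have h1 : Monotone fun n => picard N p a b n x t := fun m n hmn => hmono hmn x t
    exact (h1.iSup_nat_add 1).symm

theorem exists_measurable_modification {X : Type*} [MeasurableSpace X] {μ : Measure X} {φ : X → ℝ}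
    (hφ : AEMeasurable φ μ) (hφ0 : ∀ᵐ y ∂μ, 0 ≤ φ y) {δ : ℝ≥0∞} (h : eLpNorm φ ⊤ μ ≤ δ) :
    ∃ a : X → ℝ≥0∞, Measurable a ∧ (fun y => ENNReal.ofReal (φ y)) =ᵐ[μ] a ∧
      (∀ᵐ y ∂μ, a y ≤ δ) ∧ ∫⁻ y, a y ∂μ ≤ eLpNorm φ 1 μ ∧ (a =ᵐ[μ] 0 → φ =ᵐ[μ] 0) := by
  have hm := hφ.ennreal_ofReal
  refine ⟨hm.mk _, hm.measurable_mk, hm.ae_eq_mk, ?_, ?_, fun h0 => ?_⟩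
  · rw [eLpNorm_exponent_top] at h
    filter_upwards [hm.ae_eq_mk, enorm_ae_le_eLpNormEssSup φ μ] with y hy hle
    rw [← hy]
    exact (Real.ofReal_le_enorm _).trans (hle.trans h)
  · rw [eLpNorm_one_eq_lintegral_enorm, ← lintegral_congr_ae hm.ae_eq_mk]
    exact lintegral_mono fun y => Real.ofReal_le_enorm _
  · filter_upwards [hm.ae_eq_mk, h0, hφ0] with y hy hz h0
    rw [hz] at hy
    exact le_antisymm (ENNReal.ofReal_eq_zero.1 hy) h0

theorem exists_global_of_pF_lt {N : ℕ} (hN : 1 ≤ N) {p : ℝ} (hp : 1 < p) (hpF : pF N < p) :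
    ∃ δ : ℝ, 0 < δ ∧ ∀ (φi : Pt N → ℝ) (φb : Bd N → ℝ), IsInitialData N φi φb →
      ¬ (φi =ᵐ[volume.restrict (Omega N)] 0 ∧ φb =ᵐ[volume] 0) →
      pairNorm N 1 φi φb + pairNorm N ⊤ φi φb ≤ ENNReal.ofReal δ →
      ∃ u : Pt N → ℝ → ℝ, IsGlobalPositiveSolution N p φi φb u := by
  obtain ⟨δ, M, hδ, hM, hfix⟩ := exists_fixed_point hN hp hpF
  refine ⟨δ, hδ, fun φi φb hφ hne hnorm => ?_⟩
  have h1 : eLpNorm φi 1 (volume.restrict (Omega N)) + eLpNorm φb 1 volume ≤ ENNReal.ofReal δ :=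
    le_self_add.trans hnorm
  have hsup : pairNorm N ⊤ φi φb ≤ ENNReal.ofReal δ := le_add_self.trans hnorm
  obtain ⟨a, ha, hae, haδ, hai, ha0⟩ := exists_measurable_modification hφ.measurable_interior
    ((ae_restrict_iff' (measurableSet_Omega N)).2 (Eventually.of_forall hφ.nonneg_interior))
    (le_self_add.trans hsup)
  obtain ⟨b, hb, hbe, hbδ, hbi, hb0⟩ := exists_measurable_modification hφ.measurable_boundary
    (Eventually.of_forall hφ.nonneg_boundary) (le_add_self.trans hsup)
  have hab := (add_le_add hai hbi).trans h1
  obtain ⟨v, hv, hvM, heq⟩ := hfix a b ha hb haδ hbδ hab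
  have hfin : ∀ x ∈ OmegaBar N, ∀ t, 0 < t → v x t ≠ ∞ := fun x hx t ht =>
    ((hvM.sup_le x hx t ht).trans_lt ENNReal.ofReal_lt_top).ne
  have htimes : times ⊤ = Ioi 0 := by
    ext t
    exact mem_times_top
  refine ⟨fun x t => (v x t).toReal, ⟨fun _ _ _ _ => ENNReal.toReal_nonneg, ?_, ?_, ?_⟩, ?_⟩
  · rw [htimes]
    have hc : ContinuousOn (fun q : Pt N × ℝ => v q.1 q.2) (OmegaBar N ×ˢ Ioi 0) := by
      have hai' : ∫⁻ y in Omega N, a y ≠ ∞ :=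
        ((le_self_add.trans hab).trans_lt ENNReal.ofReal_lt_top).ne
      have hbi' : ∫⁻ y, b y ≠ ∞ := ((le_add_self.trans hab).trans_lt ENNReal.ofReal_lt_top).ne
      refine ((continuousOn_pot ha hb hai' hbi').add
        (continuousOn_duhamel hN hp.le hM hv hvM)).congr fun q _ => heq q.1 q.2
    exact ENNReal.continuousOn_toReal.comp hc fun q hq => hfin q.1 hq.1 q.2 hq.2
  · refine fun s hs _ _ => ⟨M, fun x hx t ht => ?_⟩
    have ht0 : 0 < t := (mem_times_top.1 hs).trans_le ht.1
    refine ENNReal.toReal_le_of_le_ofReal hM.le ((hvM.sup_le x hx t ht0).trans ?_)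
    refine ENNReal.ofReal_le_ofReal (mul_le_of_le_one_right hM.le
      (Real.rpow_le_one_of_one_le_of_nonpos (by linarith) ?_))
    exact div_nonpos_of_nonpos_of_nonneg (neg_nonpos.2 N.cast_nonneg) two_pos.le
  · intro x hx t ht
    have ht0 : 0 < t := mem_times_top.1 ht
    rw [ENNReal.ofReal_toReal (hfin x hx t ht0), heq x t, opG_eq_pot ht0 hx, pot_congr x hae hbe]
    congr 1
    refine setLIntegral_congr_fun measurableSet_Ioo fun s hs => ?_
    rw [opG_eq_pot (sub_pos.2 hs.2) hx]
    refine pot_congr x ?_ ?_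
    · refine (ae_restrict_iff' (measurableSet_Omega N)).2 (Eventually.of_forall fun y hy => ?_)
      beta_reduce
      rw [← ENNReal.ofReal_rpow_of_nonneg ENNReal.toReal_nonneg (by linarith),
        ENNReal.ofReal_toReal (hfin y (Omega_subset N hy) s hs.1)]
    · exact Eventually.of_forall fun y => by simp
  · intro x hx t ht
    refine ENNReal.toReal_pos ?_ (hfin x hx t ht)
    rw [heq x t]
    refine fun h0 => pot_ne_zero ht ha hb hx (fun h => hne ⟨ha0 h.1, hb0 h.2⟩) (add_eq_zero.1 h0).1

end DynHeat

end

theorem theorem3p1 (N : ℕ) (hN : 1 ≤ N) (p : ℝ) (hp : 1 < p) :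
    (p ≤ DynHeat.pF N →
      ∀ (φi : DynHeat.Pt N → ℝ) (φb : DynHeat.Bd N → ℝ), DynHeat.IsInitialData N φi φb →
        ¬ ∃ u : DynHeat.Pt N → ℝ → ℝ, DynHeat.IsGlobalPositiveSolution N p φi φb u) ∧
    (DynHeat.pF N < p →
      ∃ δ : ℝ, 0 < δ ∧
        ∀ (φi : DynHeat.Pt N → ℝ) (φb : DynHeat.Bd N → ℝ), DynHeat.IsInitialData N φi φb →
          ¬ (φi =ᵐ[MeasureTheory.volume.restrict (DynHeat.Omega N)] 0 ∧
              φb =ᵐ[MeasureTheory.volume] 0) →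
          DynHeat.pairNorm N 1 φi φb + DynHeat.pairNorm N ⊤ φi φb ≤ ENNReal.ofReal δ →
          ∃ u : DynHeat.Pt N → ℝ → ℝ, DynHeat.IsGlobalPositiveSolution N p φi φb u) :=
  ⟨fun h φi φb _ => DynHeat.not_exists_global_of_le_pF hN hp h φi φb,
    fun h => DynHeat.exists_global_of_pF_lt hN hp h⟩
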